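/- Let $n\ge 5$ be an integer and let $\mathfrak g=\mathfrak{so}(n,\mathbb C)$ be the complex Lie algebra of skew-symmetric $n\times n$ matrices. Let $\langle X,Y\rangle$ denote its Killing form. Let $\mathfrak g\circledcirc\mathfrak g\subset\mathfrak g\otimes\mathfrak g$ be the Cartan product, i.e. the unique irreducible $\mathfrak g$-submodule of $\mathfrak g\otimes\mathfrak g$ whose highest weight is twice the highest weight of the adjoint representation $\mathfrak g$, and for $X,Y\in\mathfrak g$ let $X\circledcirc Y\in\mathfrak g\circledcirc\mathfrak g\subset\mathfrak g\otimes\mathfrak g$ be the image of $X\otimes Y$ under the unique $\mathfrak g$-equivariant projection of $\mathfrak g\otimes\mathfrak g$ onto $\mathfrak g\circledcirc\mathfrak g$. Let $\lambda\in\mathbb C$ with $$\lambda\neq-\frac{n-4}{4(n-1)(n-2)}.$$ Then the two-sided ideal of the tensor algebra $\bigotimes\mathfrak g$ generated by the elements $$X\otimes Y-X\circledcirc Y-\tfrac12[X,Y]-\lambda\langle X,Y\rangle,\qquad X,Y\in\mathfrak g,$$ contains $\mathfrak g$, the first graded piece of $\bigotimes\mathfrak g$. -/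

import Mathlib

open scoped TensorProduct Matrix Kronecker

noncomputable section

namespace Joseph

/-! ### Highest weights and the Cartan product -/

section General

variable {L : Type*} [LieRing L] [LieAlgebra ℂ L]

/-- For a Borel subalgebra `b` of `L` and an irreducible `L`-module `V`: the character `χ` of `b` is
the highest weight of `V`, i.e. `b` acts through `χ` on some nonzero vector of `V`. (A character of
`b` vanishes on the nilradical of `b`, so it is the same thing as a weight of a Cartan
subalgebra contained in `b`.) -/
def IsHighestWeight (b : LieSubalgebra ℂ L) (V : Type*) [AddCommGroup V] [Module ℂ V]
    [LieRingModule L V] [LieModule ℂ L V] (χ : Module.Dual ℂ b) : Prop :=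
  ∃ v : V, v ≠ 0 ∧ ∀ X : b, ⁅(X : L), v⁆ = χ X • v

/-- `C` is an irreducible submodule of `L ⊗ L` whose highest weight is twice the highest
weight of the adjoint module `L` (highest weights with respect to the Borel subalgebra `b`). -/
structure IsCartanComponent (b : LieSubalgebra ℂ L) (C : LieSubmodule ℂ L (L ⊗[ℂ] L)) : Prop where
  irreducible : LieModule.IsIrreducible ℂ L C
  highestWeight : ∃ χ : Module.Dual ℂ b, IsHighestWeight b L χ ∧ IsHighestWeight b C (2 • χ)

/-- `P` is an invariant (that is, `L`-equivariant) projection of `L ⊗ L` onto the Cartan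
component. -/
def IsCartanProjection (b : LieSubalgebra ℂ L) (P : L ⊗[ℂ] L →ₗ⁅ℂ, L⁆ L ⊗[ℂ] L) : Prop :=
  ∃ C : LieSubmodule ℂ L (L ⊗[ℂ] L), IsCartanComponent b C ∧
    LinearMap.IsProj C.toSubmodule P.toLinearMap

/-- The inclusion of `L ⊗ L` into the tensor algebra of `L` as its piece of degree two. -/
def tensorTwo (L : Type*) [AddCommGroup L] [Module ℂ L] : L ⊗[ℂ] L →ₗ[ℂ] TensorAlgebra ℂ L :=
  TensorProduct.lift
    ((LinearMap.mul ℂ (TensorAlgebra ℂ L)).compl₁₂ (TensorAlgebra.ι ℂ) (TensorAlgebra.ι ℂ))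

end General

/-! ### The Lie algebra `so(n, ℂ)` and its standard Borel subalgebra -/

attribute [local instance 100] LieRing.ofAssociativeRing

/-- `so(n, ℂ)`: skew complex `n × n` matrices. -/
abbrev so (n : ℕ) : LieSubalgebra ℂ (Matrix (Fin n) (Fin n) ℂ) :=
  LieAlgebra.Orthogonal.so (Fin n) ℂ

/-- The vector `e_{2j} + i e_{2j+1}` (coordinates are numbered from `0`). For `2 j + 1 < n` these
vectors span a maximal isotropic subspace of `ℂⁿ` with its standard quadratic form. -/
def isoVec (n j : ℕ) : Fin n → ℂ := fun a =>
  if (a : ℕ) = 2 * j then 1 else if (a : ℕ) = 2 * j + 1 then Complex.I else 0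

/-- The standard isotropic flag: the span of the first `k` vectors `isoVec n j`. -/
def isoFlag (n k : ℕ) : Submodule ℂ (Fin n → ℂ) :=
  Submodule.span ℂ {x | ∃ j < k, x = isoVec n j}

/-- The standard Borel subalgebra of `so(n, ℂ)`: the stabilizer of the complete isotropic flag
`isoFlag n 1 ⊂ isoFlag n 2 ⊂ ⋯ ⊂ isoFlag n ⌊n/2⌋`. -/
def borel (n : ℕ) : LieSubalgebra ℂ (so n) where
  carrier := {X | ∀ k, 2 * k ≤ n → ∀ x ∈ isoFlag n k, (X : Matrix (Fin n) (Fin n) ℂ) *ᵥ x ∈ isoFlag n k}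
  zero_mem' := fun k _ x _ => by simp
  add_mem' := fun {X Y} hX hY k hk x hx => by
    simpa [Matrix.add_mulVec] using add_mem (hX k hk x hx) (hY k hk x hx)
  smul_mem' := fun c X hX k hk x hx => by
    simpa [Matrix.smul_mulVec] using Submodule.smul_mem _ c (hX k hk x hx)
  lie_mem' := fun {X Y} hX hY k hk x hx => by
    simpa [Ring.lie_def, Matrix.sub_mulVec, ← Matrix.mulVec_mulVec] using
      sub_mem (hX k hk _ (hY k hk x hx)) (hY k hk _ (hX k hk x hx))

/-! ### Existence and uniqueness of the invariant projection onto the Cartan component -/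

section Wedge

variable {n : ℕ}

/-- The skew matrix `x yᵀ - y xᵀ`. -/
def wedge : (Fin n → ℂ) →ₗ[ℂ] (Fin n → ℂ) →ₗ[ℂ] so n :=
  LinearMap.mk₂ ℂ
    (fun x y => ⟨Matrix.vecMulVec x y - Matrix.vecMulVec y x, by
      rw [LieAlgebra.Orthogonal.mem_so]; simp⟩)
    (fun x x' y => by
      apply Subtype.ext; ext i j; simp [Matrix.vecMulVec_apply]; ring)
    (fun c x y => by
      apply Subtype.ext; ext i j; simp [Matrix.vecMulVec_apply]; ring)
    (fun x y y' => by
      apply Subtype.ext; ext i j; simp [Matrix.vecMulVec_apply]; ring)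
    (fun c x y => by
      apply Subtype.ext; ext i j; simp [Matrix.vecMulVec_apply]; ring)

theorem coe_wedge (x y : Fin n → ℂ) :
    (wedge x y : Matrix (Fin n) (Fin n) ℂ) = Matrix.vecMulVec x y - Matrix.vecMulVec y x := rfl

theorem wedge_apply (x y : Fin n → ℂ) (i j : Fin n) :
    (wedge x y : Matrix (Fin n) (Fin n) ℂ) i j = x i * y j - y i * x j := rfl

theorem wedge_mulVec (x y z : Fin n → ℂ) :
    (wedge x y : Matrix (Fin n) (Fin n) ℂ) *ᵥ z = (y ⬝ᵥ z) • x - (x ⬝ᵥ z) • y := by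
  rw [coe_wedge, Matrix.sub_mulVec, Matrix.vecMulVec_mulVec, Matrix.vecMulVec_mulVec]
  simp

theorem wedge_self (x : Fin n → ℂ) : wedge x x = 0 := by
  apply Subtype.ext; simp [coe_wedge]

theorem wedge_swap (x y : Fin n → ℂ) : wedge x y = - wedge y x := by
  apply Subtype.ext; simp [coe_wedge]

theorem so_skew (X : so n) (i j : Fin n) :
    (X : Matrix (Fin n) (Fin n) ℂ) i j = - (X : Matrix (Fin n) (Fin n) ℂ) j i := by
  have h := (LieAlgebra.Orthogonal.mem_so (Fin n) ℂ _).1 X.2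
  simpa using congrFun (congrFun h j) i

theorem lie_wedge (X : so n) (x y : Fin n → ℂ) :
    ⁅X, wedge x y⁆ = wedge ((X : Matrix (Fin n) (Fin n) ℂ) *ᵥ x) y +
      wedge x ((X : Matrix (Fin n) (Fin n) ℂ) *ᵥ y) := by
  have h : ∀ z : Fin n → ℂ, z ᵥ* (X : Matrix (Fin n) (Fin n) ℂ) =
      - ((X : Matrix (Fin n) (Fin n) ℂ) *ᵥ z) := by
    intro z
    rw [← Matrix.mulVec_transpose, (LieAlgebra.Orthogonal.mem_so (Fin n) ℂ _).1 X.2,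
      Matrix.neg_mulVec]
  apply Subtype.ext
  simp only [LieSubalgebra.coe_bracket, Ring.lie_def, AddMemClass.coe_add, coe_wedge,
    mul_sub, sub_mul, Matrix.mul_vecMulVec, Matrix.vecMulVec_mul, h]
  ext i j
  simp [Matrix.vecMulVec_apply]
  ring

theorem mem_of_wedge_mem (W : Submodule ℂ (so n)) (hW : ∀ x y, wedge x y ∈ W) (X : so n) :
    X ∈ W := by
  have : X = (1 / 2 : ℂ) • ∑ a, wedge (Pi.single a 1)
      ((X : Matrix (Fin n) (Fin n) ℂ) a) := by
    apply Subtype.ext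
    ext i j
    have h := so_skew X j i
    rw [SetLike.val_smul, AddSubmonoidClass.coe_finsetSum, Matrix.smul_apply, Matrix.sum_apply]
    simp only [wedge_apply, Finset.sum_sub_distrib, Pi.single_apply, ite_mul, one_mul, zero_mul,
      mul_ite, mul_one, mul_zero, Finset.sum_ite_eq, Finset.mem_univ, if_true, smul_eq_mul]
    rw [h]
    ring
  rw [this]
  exact W.smul_mem _ (W.sum_mem fun a _ => hW _ _)

/-- The conjugate isotropic vector `e_{2j} - i e_{2j+1}`. -/
def isoVec' (n j : ℕ) : Fin n → ℂ := fun a =>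
  if (a : ℕ) = 2 * j then 1 else if (a : ℕ) = 2 * j + 1 then -Complex.I else 0

theorem isoVec_eq {j : ℕ} (h : 2 * j + 1 < n) : isoVec n j =
    Pi.single ⟨2 * j, by omega⟩ 1 + Complex.I • Pi.single ⟨2 * j + 1, h⟩ 1 := by
  ext a
  simp only [isoVec, Pi.add_apply, Pi.smul_apply, Pi.single_apply, Fin.ext_iff, smul_eq_mul]
  split_ifs <;> first | omega | simp

theorem isoVec'_eq {j : ℕ} (h : 2 * j + 1 < n) : isoVec' n j =
    Pi.single ⟨2 * j, by omega⟩ 1 - Complex.I • Pi.single ⟨2 * j + 1, h⟩ 1 := by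
  ext a
  simp only [isoVec', Pi.sub_apply, Pi.smul_apply, Pi.single_apply, Fin.ext_iff, smul_eq_mul]
  split_ifs <;> first | omega | simp

theorem isoVec_dot {j : ℕ} (h : 2 * j + 1 < n) (x : Fin n → ℂ) :
    isoVec n j ⬝ᵥ x = x ⟨2 * j, by omega⟩ + Complex.I * x ⟨2 * j + 1, h⟩ := by
  simp [isoVec_eq h, add_dotProduct, smul_dotProduct]

theorem isoVec'_dot {j : ℕ} (h : 2 * j + 1 < n) (x : Fin n → ℂ) :
    isoVec' n j ⬝ᵥ x = x ⟨2 * j, by omega⟩ - Complex.I * x ⟨2 * j + 1, h⟩ := by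
  simp [isoVec'_eq h, sub_dotProduct, smul_dotProduct]

theorem isoVec_dot_isoVec {j k : ℕ} (h : 2 * j + 1 < n) : isoVec n j ⬝ᵥ isoVec n k = 0 := by
  rw [isoVec_dot h]
  simp only [isoVec]
  split_ifs <;> first | omega | simp

theorem isoVec_dot_isoVec' {j k : ℕ} (h : 2 * j + 1 < n) :
    isoVec n j ⬝ᵥ isoVec' n k = if j = k then 2 else 0 := by
  rw [isoVec_dot h]
  simp only [isoVec']
  split_ifs <;> first | omega | (simp; try norm_num)

theorem isoVec'_dot_isoVec {j k : ℕ} (h : 2 * j + 1 < n) :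
    isoVec' n j ⬝ᵥ isoVec n k = if j = k then 2 else 0 := by
  rw [isoVec'_dot h]
  simp only [isoVec]
  split_ifs <;> first | omega | (simp; try norm_num)

theorem isoVec'_dot_isoVec' {j k : ℕ} (h : 2 * j + 1 < n) :
    isoVec' n j ⬝ᵥ isoVec' n k = 0 := by
  rw [isoVec'_dot h]
  simp only [isoVec']
  split_ifs <;> first | omega | simp

/-- An element of the standard Cartan subalgebra. -/
def cartanElt (n j : ℕ) : so n := (1 / 2 : ℂ) • wedge (isoVec n j) (isoVec' n j)

theorem cartanElt_mulVec (j : ℕ) (x : Fin n → ℂ) :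
    (cartanElt n j : Matrix (Fin n) (Fin n) ℂ) *ᵥ x =
      (1 / 2 : ℂ) • ((isoVec' n j ⬝ᵥ x) • isoVec n j - (isoVec n j ⬝ᵥ x) • isoVec' n j) := by
  rw [cartanElt, SetLike.val_smul, Matrix.smul_mulVec, wedge_mulVec]

theorem isoVec_mem_isoFlag {j k : ℕ} (h : j < k) : isoVec n j ∈ isoFlag n k :=
  Submodule.subset_span ⟨j, h, rfl⟩

theorem mem_borel_iff (X : so n) : X ∈ borel n ↔ ∀ j, 2 * j + 1 < n →
    (X : Matrix (Fin n) (Fin n) ℂ) *ᵥ isoVec n j ∈ isoFlag n (j + 1) := by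
  constructor
  · intro h j hj
    exact h (j + 1) (by omega) _ (isoVec_mem_isoFlag (Nat.lt_succ_self j))
  · intro h k hk x hx
    induction hx using Submodule.span_induction with
    | mem x hx =>
      obtain ⟨j, hj, rfl⟩ := hx
      refine (Submodule.span_mono ?_) (h j (by omega))
      rintro _ ⟨i, hi, rfl⟩
      exact ⟨i, by omega, rfl⟩
    | zero => simp
    | add x y _ _ hx hy => rw [Matrix.mulVec_add]; exact add_mem hx hy
    | smul c x _ hx => rw [Matrix.mulVec_smul]; exact Submodule.smul_mem _ c hx

theorem cartanElt_mem_borel {j : ℕ} (hj : 2 * j + 1 < n) : cartanElt n j ∈ borel n := by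
  rw [mem_borel_iff]
  intro k hk
  rw [cartanElt_mulVec, isoVec_dot_isoVec hj, isoVec'_dot_isoVec hj]
  split_ifs with h
  · subst h
    simpa using isoVec_mem_isoFlag (Nat.lt_succ_self j)
  · simp

/-- Elements `isoVec n j ∧ y` of the Borel subalgebra, for `y` supported in the
coordinates beyond `2 j + 1`. -/
theorem wedge_mem_borel {j : ℕ} (hj : 2 * j + 1 < n) (y : Fin n → ℂ)
    (hy : ∀ a : Fin n, (a : ℕ) ≤ 2 * j + 1 → y a = 0) : wedge (isoVec n j) y ∈ borel n := by
  rw [mem_borel_iff]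
  intro k hk
  rw [wedge_mulVec, isoVec_dot_isoVec hj, zero_smul, sub_zero]
  by_cases h : j < k + 1
  · exact Submodule.smul_mem _ _ (isoVec_mem_isoFlag h)
  · rw [dotProduct_comm, isoVec_dot hk, hy _ (by simp; omega), hy _ (by simp; omega)]
    simp

theorem lie_cartanElt_wedge {j : ℕ} (hj : 2 * j + 1 < n) (y : Fin n → ℂ)
    (hy : ∀ a : Fin n, (a : ℕ) ≤ 2 * j + 1 → y a = 0) :
    ⁅cartanElt n j, wedge (isoVec n j) y⁆ = wedge (isoVec n j) y := by
  rw [lie_wedge, cartanElt_mulVec, cartanElt_mulVec, isoVec_dot_isoVec hj, isoVec'_dot_isoVec hj,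
    isoVec'_dot hj, isoVec_dot hj, hy _ (by simp), hy _ (by simp)]
  simp

/-- The highest root vector of `so(n, ℂ)`. -/
def rootVec (n : ℕ) : so n := wedge (isoVec n 0) (isoVec n 1)

theorem lie_wedge_eq_zero {w : so n} {χ : Module.Dual ℂ (borel n)}
    (hw : ∀ X : borel n, ⁅(X : so n), w⁆ = χ X • w) {j : ℕ} (hj : 2 * j + 1 < n)
    (y : Fin n → ℂ) (hy : ∀ a : Fin n, (a : ℕ) ≤ 2 * j + 1 → y a = 0) :
    ⁅w, wedge (isoVec n j) y⁆ = 0 := by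
  have h1 : ⁅cartanElt n j, w⁆ = χ ⟨_, cartanElt_mem_borel hj⟩ • w :=
    hw ⟨_, cartanElt_mem_borel hj⟩
  have h2 : ⁅wedge (isoVec n j) y, w⁆ = χ ⟨_, wedge_mem_borel hj y hy⟩ • w :=
    hw ⟨_, wedge_mem_borel hj y hy⟩
  rw [← lie_skew, neg_eq_zero, ← lie_cartanElt_wedge hj y hy, lie_lie, h1, h2, lie_smul, lie_smul,
    h1, h2, smul_comm, sub_self]

theorem entry_relation {w : so n} {χ : Module.Dual ℂ (borel n)}
    (hw : ∀ X : borel n, ⁅(X : so n), w⁆ = χ X • w) {j : ℕ} (hj : 2 * j + 1 < n)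
    (a : Fin n) (ha : 2 * j + 1 < (a : ℕ)) (c d : Fin n) :
    ((w : Matrix (Fin n) (Fin n) ℂ) c ⟨2 * j, by omega⟩ +
        Complex.I * (w : Matrix (Fin n) (Fin n) ℂ) c ⟨2 * j + 1, hj⟩) * (if d = a then 1 else 0) -
      (if c = a then 1 else 0) * ((w : Matrix (Fin n) (Fin n) ℂ) d ⟨2 * j, by omega⟩ +
        Complex.I * (w : Matrix (Fin n) (Fin n) ℂ) d ⟨2 * j + 1, hj⟩) +
      (isoVec n j c * (w : Matrix (Fin n) (Fin n) ℂ) d a -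
        (w : Matrix (Fin n) (Fin n) ℂ) c a * isoVec n j d) = 0 := by
  have h := lie_wedge_eq_zero hw hj (Pi.single a 1) (by
    intro b hb
    rw [Pi.single_apply, if_neg]
    rintro rfl
    omega)
  have h' := congrFun (congrFun (congrArg Subtype.val h) c) d
  rw [lie_wedge, AddMemClass.coe_add, Matrix.add_apply, wedge_apply, wedge_apply] at h'
  have hp : ∀ e, ((w : Matrix (Fin n) (Fin n) ℂ) *ᵥ isoVec n j) e =
      (w : Matrix (Fin n) (Fin n) ℂ) e ⟨2 * j, by omega⟩ +
        Complex.I * (w : Matrix (Fin n) (Fin n) ℂ) e ⟨2 * j + 1, hj⟩ := by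
    intro e
    rw [Matrix.mulVec, dotProduct_comm, isoVec_dot hj]
  rw [hp, hp] at h'
  simpa [Pi.single_apply] using h'

theorem eq_smul_rootVec (hn : 5 ≤ n) {w : so n} {χ : Module.Dual ℂ (borel n)}
    (hw : ∀ X : borel n, ⁅(X : so n), w⁆ = χ X • w) : ∃ c : ℂ, w = c • rootVec n := by
  obtain ⟨A, hA⟩ : ∃ A : Fin n → Fin n → ℂ, (w : Matrix (Fin n) (Fin n) ℂ) = A := ⟨_, rfl⟩
  have p0 : 0 < n := by omega
  have p1 : 1 < n := by omega
  have p2 : 2 < n := by omega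
  have p3 : 3 < n := by omega
  have skew : ∀ i j, A i j = - A j i := by intro i j; rw [← hA]; exact so_skew w i j
  have diag : ∀ i, A i i = 0 := fun i => by
    have := skew i i
    linear_combination this / 2
  have r0 := fun a ha c d => entry_relation hw (j := 0) (by omega) a ha c d
  have r1 := fun a ha c d => entry_relation hw (j := 1) (by omega) a ha c d
  simp only [hA, isoVec] at r0 r1
  simp only [Nat.mul_zero, Nat.zero_add, Nat.mul_one] at r0 r1
  -- entries away from the first two coordinates vanish
  have h1 : ∀ a b : Fin n, 1 < (a : ℕ) → 1 < (b : ℕ) → A a b = 0 := by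
    intro a b ha hb
    by_cases hab : a = b
    · rw [hab]; exact diag b
    have := r0 b hb ⟨0, by omega⟩ a
    have e1 : ¬ (⟨0, by omega⟩ : Fin n) = b := by rw [Fin.ext_iff]; simp; omega
    rw [if_neg hab, if_neg e1, if_pos rfl, if_neg (by omega : ¬ (a : ℕ) = 0),
      if_neg (by omega : ¬ (a : ℕ) = 1)] at this
    linear_combination this
  have h2 : A ⟨0, by omega⟩ ⟨1, by omega⟩ = 0 := by
    have := r0 ⟨2, by omega⟩ (by simp) ⟨0, by omega⟩ ⟨2, by omega⟩
    simp [diag] at this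
    exact this
  have h3 : ∀ b : Fin n, 1 < (b : ℕ) →
      A b ⟨0, by omega⟩ + Complex.I * A b ⟨1, by omega⟩ = 0 := by
    intro b hb
    obtain ⟨a, ha, hab⟩ : ∃ a : Fin n, 1 < (a : ℕ) ∧ b ≠ a := by
      by_cases h : (b : ℕ) = 2
      · exact ⟨⟨3, by omega⟩, by simp, by rw [Ne, Fin.ext_iff]; simp; omega⟩
      · exact ⟨⟨2, by omega⟩, by simp, by rw [Ne, Fin.ext_iff]; simpa using h⟩
    have := r0 a ha b a
    rw [if_pos rfl, if_neg hab, if_neg (by omega : ¬ (a : ℕ) = 0),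
      if_neg (by omega : ¬ (a : ℕ) = 1), if_neg (by omega : ¬ (b : ℕ) = 0),
      if_neg (by omega : ¬ (b : ℕ) = 1)] at this
    linear_combination this
  have h4 : A ⟨0, by omega⟩ ⟨2, by omega⟩ + Complex.I * A ⟨0, by omega⟩ ⟨3, by omega⟩ = 0 := by
    have := r1 ⟨4, by omega⟩ (by simp) ⟨0, by omega⟩ ⟨4, by omega⟩
    simpa using this
  have h5 : ∀ b : Fin n, 3 < (b : ℕ) → A ⟨0, by omega⟩ b = 0 := by
    intro b hb
    have := r1 b hb ⟨0, by omega⟩ ⟨2, by omega⟩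
    have e1 : ¬ (⟨0, by omega⟩ : Fin n) = b := by rw [Fin.ext_iff]; simp; omega
    have e2 : ¬ (⟨2, by omega⟩ : Fin n) = b := by rw [Fin.ext_iff]; simp; omega
    rw [if_neg e1, if_neg e2] at this
    simpa using this
  have h6 : ∀ b : Fin n, 1 < (b : ℕ) →
      A ⟨0, by omega⟩ b = A ⟨0, by omega⟩ ⟨2, by omega⟩ * isoVec n 1 b := by
    intro b hb
    by_cases hb2 : (b : ℕ) = 2
    · obtain rfl : b = ⟨2, p2⟩ := Fin.ext hb2
      simp [isoVec]
    by_cases hb3 : (b : ℕ) = 3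
    · obtain rfl : b = ⟨3, p3⟩ := Fin.ext hb3
      simp [isoVec]
      linear_combination (-Complex.I) * h4 + A ⟨0, by omega⟩ ⟨3, by omega⟩ * Complex.I_sq
    · rw [h5 b (by omega)]
      simp [isoVec, hb2, hb3]
  have h7 : ∀ b : Fin n, 1 < (b : ℕ) →
      A ⟨1, by omega⟩ b = Complex.I * A ⟨0, by omega⟩ b := by
    intro b hb
    rw [skew _ b, skew _ b]
    linear_combination Complex.I * h3 b hb - A b ⟨1, by omega⟩ * Complex.I_sq
  have h8 : ∀ a b : Fin n, (a : ℕ) ≤ 1 → 1 < (b : ℕ) →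
      A a b = A ⟨0, by omega⟩ ⟨2, by omega⟩ * (isoVec n 0 a * isoVec n 1 b) := by
    intro a b ha hb
    by_cases h : (a : ℕ) = 0
    · obtain rfl : a = ⟨0, p0⟩ := Fin.ext h
      rw [h6 b hb]; simp [isoVec]
    · obtain rfl : a = ⟨1, p1⟩ := Fin.ext (by simp; omega)
      have e : isoVec n 0 ⟨1, p1⟩ = Complex.I := by simp [isoVec]
      rw [h7 b hb, h6 b hb, e]; ring
  have z0 : ∀ a : Fin n, 1 < (a : ℕ) → isoVec n 0 a = 0 := fun a ha => by
    simp only [isoVec]; rw [if_neg (by omega), if_neg (by omega)]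
  have z1 : ∀ a : Fin n, (a : ℕ) ≤ 1 → isoVec n 1 a = 0 := fun a ha => by
    simp only [isoVec]; rw [if_neg (by omega), if_neg (by omega)]
  refine ⟨A ⟨0, by omega⟩ ⟨2, by omega⟩, ?_⟩
  apply Subtype.ext
  ext i j
  rw [SetLike.val_smul, Matrix.smul_apply, rootVec, wedge_apply, hA, smul_eq_mul]
  rcases Nat.lt_or_ge 1 (i : ℕ) with hi | hi <;> rcases Nat.lt_or_ge 1 (j : ℕ) with hj | hj
  · rw [h1 i j hi hj, z0 i hi, z0 j hj]; ring
  · rw [skew, h8 j i hj hi, z0 i hi, z1 j hj]; ring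
  · rw [h8 i j hi hj, z0 j hj, z1 i hi]; ring
  · rw [z1 i hi, z1 j hj]
    by_cases hij : i = j
    · rw [hij, diag]; ring
    by_cases h : (i : ℕ) = 0
    · obtain rfl : i = ⟨0, p0⟩ := Fin.ext h
      obtain rfl : j = ⟨1, p1⟩ := Fin.ext (by
        have : ¬ 0 = (j : ℕ) := fun h => hij (Fin.ext h)
        simp; omega)
      rw [h2]; ring
    · obtain rfl : i = ⟨1, p1⟩ := Fin.ext (by simp; omega)
      obtain rfl : j = ⟨0, p0⟩ := Fin.ext (by
        have : ¬ 1 = (j : ℕ) := fun h => hij (Fin.ext h)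
        simp; omega)
      rw [skew, h2]; ring

theorem rootVec_ne_zero (hn : 5 ≤ n) : rootVec n ≠ 0 := by
  intro h
  have := congrFun (congrFun (congrArg Subtype.val h) ⟨0, by omega⟩) ⟨2, by omega⟩
  rw [rootVec, wedge_apply] at this
  simp [isoVec] at this

theorem lie_rootVec (hn : 5 ≤ n) (X : borel n) : ∃ c : ℂ, ⁅(X : so n), rootVec n⁆ = c • rootVec n := by
  obtain ⟨X, hX⟩ := X
  have h0 := (mem_borel_iff X).1 hX 0 (by omega)
  have h1 := (mem_borel_iff X).1 hX 1 (by omega)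
  have f1 : isoFlag n 1 ≤ Submodule.span ℂ {isoVec n 0} := by
    apply Submodule.span_mono
    rintro _ ⟨j, hj, rfl⟩
    obtain rfl : j = 0 := by omega
    rfl
  have f2 : isoFlag n 2 ≤ Submodule.span ℂ {isoVec n 0, isoVec n 1} := by
    apply Submodule.span_mono
    rintro _ ⟨j, hj, rfl⟩
    obtain rfl | rfl : j = 0 ∨ j = 1 := by omega
    · exact Or.inl rfl
    · exact Or.inr rfl
  obtain ⟨a, ha⟩ := Submodule.mem_span_singleton.1 (f1 h0)
  obtain ⟨b, c, hbc⟩ := Submodule.mem_span_pair.1 (f2 h1)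
  refine ⟨a + c, ?_⟩
  rw [rootVec, lie_wedge, ← ha, ← hbc]
  simp [wedge_self, add_smul]

/-- The highest weight of the adjoint module of `so(n, ℂ)`. -/
theorem exists_highestWeight (hn : 5 ≤ n) :
    ∃ χ : Module.Dual ℂ (borel n), ∀ X : borel n, ⁅(X : so n), rootVec n⁆ = χ X • rootVec n := by
  let χ : Module.Dual ℂ (borel n) :=
    { toFun := fun X => (⁅(X : so n), rootVec n⁆ : so n).1 ⟨0, by omega⟩ ⟨2, by omega⟩
      map_add' := fun X Y => by simp
      map_smul' := fun c X => by simp }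
  refine ⟨χ, fun X => ?_⟩
  obtain ⟨c, hc⟩ := lie_rootVec hn X
  have : χ X = c := by
    change (⁅(X : so n), rootVec n⁆ : so n).1 ⟨0, by omega⟩ ⟨2, by omega⟩ = c
    rw [hc, SetLike.val_smul, Matrix.smul_apply, rootVec, wedge_apply]
    simp [isoVec]
  rw [this, hc]

/-- The span of the eigenvectors of `A` with integral eigenvalue less than `k`. -/
def lowerPart {V : Type*} [AddCommGroup V] [Module ℂ V] (A : V →ₗ[ℂ] V) (k : ℤ) :
    Submodule ℂ V :=
  Submodule.span ℂ {x | ∃ m : ℤ, m < k ∧ A x = (m : ℂ) • x}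

theorem lowerPart_mono {V : Type*} [AddCommGroup V] [Module ℂ V] (A : V →ₗ[ℂ] V) {k l : ℤ}
    (h : k ≤ l) : lowerPart A k ≤ lowerPart A l :=
  Submodule.span_mono fun _ ⟨m, hm, hx⟩ => ⟨m, by omega, hx⟩

theorem eq_zero_of_mem_lowerPart {V : Type*} [AddCommGroup V] [Module ℂ V] (A : V →ₗ[ℂ] V) {k : ℤ}
    {x : V} (hx : x ∈ lowerPart A k) (h : A x = (k : ℂ) • x) : x = 0 := by
  have h1 := Module.End.eigenspaces_iSupIndep A (k : ℂ)
  refine (Submodule.disjoint_def.1 h1) x (Module.End.mem_eigenspace_iff.2 h) ?_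
  refine (Submodule.span_le.2 ?_) hx
  rintro y ⟨m, hm, hy⟩
  have hne : (m : ℂ) ≠ (k : ℂ) := by exact_mod_cast hm.ne
  exact Submodule.mem_iSup_of_mem (m : ℂ) (Submodule.mem_iSup_of_mem hne
    (Module.End.mem_eigenspace_iff.2 hy))

/-- The coweight used to separate the highest weight from all others. -/
def coweight (n : ℕ) : so n := cartanElt n 0 + cartanElt n 1

theorem coweight_mem_borel (hn : 5 ≤ n) : coweight n ∈ borel n :=
  add_mem (cartanElt_mem_borel (by omega)) (cartanElt_mem_borel (by omega))

theorem coweight_mulVec (x : Fin n → ℂ) :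
    (coweight n : Matrix (Fin n) (Fin n) ℂ) *ᵥ x =
      (1 / 2 : ℂ) • ((isoVec' n 0 ⬝ᵥ x) • isoVec n 0 - (isoVec n 0 ⬝ᵥ x) • isoVec' n 0) +
      (1 / 2 : ℂ) • ((isoVec' n 1 ⬝ᵥ x) • isoVec n 1 - (isoVec n 1 ⬝ᵥ x) • isoVec' n 1) := by
  rw [coweight, AddMemClass.coe_add, Matrix.add_mulVec, cartanElt_mulVec, cartanElt_mulVec]

theorem exists_eigen_decomp (hn : 5 ≤ n) (x : Fin n → ℂ) :
    ∃ a b : ℂ, ∃ y z : Fin n → ℂ, x = a • isoVec n 0 + b • isoVec n 1 + y + z ∧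
      (coweight n : Matrix (Fin n) (Fin n) ℂ) *ᵥ y = ((-1 : ℤ) : ℂ) • y ∧
      (coweight n : Matrix (Fin n) (Fin n) ℂ) *ᵥ z = ((0 : ℤ) : ℂ) • z := by
  have k0 : 2 * 0 + 1 < n := by omega
  have k1 : 2 * 1 + 1 < n := by omega
  let y : Fin n → ℂ := (1 / 2 * (isoVec n 0 ⬝ᵥ x)) • isoVec' n 0 +
    (1 / 2 * (isoVec n 1 ⬝ᵥ x)) • isoVec' n 1
  let w : Fin n → ℂ := (1 / 2 * (isoVec' n 0 ⬝ᵥ x)) • isoVec n 0 +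
    (1 / 2 * (isoVec' n 1 ⬝ᵥ x)) • isoVec n 1
  refine ⟨1 / 2 * (isoVec' n 0 ⬝ᵥ x), 1 / 2 * (isoVec' n 1 ⬝ᵥ x), y, x - w - y, ?_, ?_, ?_⟩
  · simp only [w]; abel
  · rw [coweight_mulVec]
    simp only [y, dotProduct_add, dotProduct_smul, isoVec_dot_isoVec' k0, isoVec_dot_isoVec' k1,
      isoVec'_dot_isoVec' k0, isoVec'_dot_isoVec' k1]
    ext i
    simp
    ring
  · rw [coweight_mulVec]
    simp only [y, w, dotProduct_sub, dotProduct_add, dotProduct_smul, isoVec_dot_isoVec' k0,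
      isoVec_dot_isoVec' k1, isoVec'_dot_isoVec' k0, isoVec'_dot_isoVec' k1, isoVec_dot_isoVec k0,
      isoVec_dot_isoVec k1, isoVec'_dot_isoVec k0, isoVec'_dot_isoVec k1]
    ext i
    simp
    ring

theorem coweight_mulVec_isoVec (hn : 5 ≤ n) {j : ℕ} (hj : j < 2) :
    (coweight n : Matrix (Fin n) (Fin n) ℂ) *ᵥ isoVec n j = ((1 : ℤ) : ℂ) • isoVec n j := by
  have k0 : 2 * 0 + 1 < n := by omega
  have k1 : 2 * 1 + 1 < n := by omega
  rw [coweight_mulVec, isoVec_dot_isoVec k0, isoVec_dot_isoVec k1, isoVec'_dot_isoVec k0,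
    isoVec'_dot_isoVec k1]
  obtain rfl | rfl : j = 0 ∨ j = 1 := by omega
  all_goals simp

theorem lie_coweight_wedge {x y : Fin n → ℂ} {k l : ℤ}
    (hx : (coweight n : Matrix (Fin n) (Fin n) ℂ) *ᵥ x = (k : ℂ) • x)
    (hy : (coweight n : Matrix (Fin n) (Fin n) ℂ) *ᵥ y = (l : ℂ) • y) :
    ⁅coweight n, wedge x y⁆ = ((k + l : ℤ) : ℂ) • wedge x y := by
  rw [lie_wedge, hx, hy]
  simp [add_smul]

theorem lie_coweight_rootVec (hn : 5 ≤ n) : ⁅coweight n, rootVec n⁆ = ((2 : ℤ) : ℂ) • rootVec n :=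
  lie_coweight_wedge (coweight_mulVec_isoVec hn (by omega)) (coweight_mulVec_isoVec hn (by omega))

theorem so_decomp (hn : 5 ≤ n) (X : so n) : X ∈ Submodule.span ℂ {rootVec n} ⊔
    lowerPart (LieModule.toEnd ℂ (so n) (so n) (coweight n)) 2 := by
  apply mem_of_wedge_mem
  intro x x'
  obtain ⟨a, b, y, z, rfl, hy, hz⟩ := exists_eigen_decomp hn x
  obtain ⟨a', b', y', z', rfl, hy', hz'⟩ := exists_eigen_decomp hn x'
  have h0 := coweight_mulVec_isoVec hn (show 0 < 2 by omega)
  have h1 := coweight_mulVec_isoVec hn (show 1 < 2 by omega)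
  have key : ∀ {x y : Fin n → ℂ} {k l : ℤ},
      (coweight n : Matrix (Fin n) (Fin n) ℂ) *ᵥ x = (k : ℂ) • x →
      (coweight n : Matrix (Fin n) (Fin n) ℂ) *ᵥ y = (l : ℂ) • y → k + l < 2 →
      wedge x y ∈ Submodule.span ℂ {rootVec n} ⊔
        lowerPart (LieModule.toEnd ℂ (so n) (so n) (coweight n)) 2 := fun hx hy hkl =>
    Submodule.mem_sup_right (Submodule.subset_span ⟨_, hkl, lie_coweight_wedge hx hy⟩)
  have hr : wedge (isoVec n 0) (isoVec n 1) ∈ Submodule.span ℂ {rootVec n} ⊔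
        lowerPart (LieModule.toEnd ℂ (so n) (so n) (coweight n)) 2 :=
    Submodule.mem_sup_left (Submodule.mem_span_singleton_self _)
  have hr' : wedge (isoVec n 1) (isoVec n 0) ∈ Submodule.span ℂ {rootVec n} ⊔
        lowerPart (LieModule.toEnd ℂ (so n) (so n) (coweight n)) 2 := by
    rw [wedge_swap]; exact neg_mem hr
  simp only [map_add, map_smul, LinearMap.add_apply, LinearMap.smul_apply, wedge_self]
  repeat' first
    | apply Submodule.add_mem
    | apply Submodule.smul_mem
    | exact hr
    | exact hr'
    | exact Submodule.zero_mem _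
  all_goals first
    | exact key h0 hy' (by norm_num)
    | exact key h0 hz' (by norm_num)
    | exact key h1 hy' (by norm_num)
    | exact key h1 hz' (by norm_num)
    | exact key hy h0 (by norm_num)
    | exact key hy h1 (by norm_num)
    | exact key hy hy' (by norm_num)
    | exact key hy hz' (by norm_num)
    | exact key hz h0 (by norm_num)
    | exact key hz h1 (by norm_num)
    | exact key hz hy' (by norm_num)
    | exact key hz hz' (by norm_num)

theorem tmul_mem_lowerPart (H : so n) {k l m : ℤ} (hm : k + l - 1 ≤ m) {x y : so n}
    (hx : x ∈ lowerPart (LieModule.toEnd ℂ (so n) (so n) H) k)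
    (hy : y ∈ lowerPart (LieModule.toEnd ℂ (so n) (so n) H) l) :
    x ⊗ₜ[ℂ] y ∈ lowerPart (LieModule.toEnd ℂ (so n) (so n ⊗[ℂ] so n) H) m := by
  induction hx using Submodule.span_induction with
  | zero => simp
  | add x x' _ _ h h' => rw [TensorProduct.add_tmul]; exact add_mem h h'
  | smul c x _ h => rw [← TensorProduct.smul_tmul']; exact Submodule.smul_mem _ c h
  | mem x hx =>
    induction hy using Submodule.span_induction with
    | zero => simp
    | add y y' _ _ h h' => rw [TensorProduct.tmul_add]; exact add_mem h h'
    | smul c y _ h => rw [TensorProduct.tmul_smul]; exact Submodule.smul_mem _ c h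
    | mem y hy =>
      obtain ⟨a, ha, hx⟩ := hx
      obtain ⟨b, hb, hy⟩ := hy
      refine Submodule.subset_span ⟨a + b, by omega, ?_⟩
      rw [LieModule.toEnd_apply_apply] at hx hy ⊢
      rw [TensorProduct.LieModule.lie_tmul_right, hx, hy, TensorProduct.tmul_smul,
        ← TensorProduct.smul_tmul', ← add_smul]
      push_cast
      rfl

/-- The highest weight vector of the Cartan component. -/
def cartanVec (n : ℕ) : so n ⊗[ℂ] so n := rootVec n ⊗ₜ rootVec n

theorem lie_coweight_cartanVec (hn : 5 ≤ n) :
    ⁅coweight n, cartanVec n⁆ = ((4 : ℤ) : ℂ) • cartanVec n := by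
  rw [cartanVec, TensorProduct.LieModule.lie_tmul_right, lie_coweight_rootVec hn,
    TensorProduct.tmul_smul, ← TensorProduct.smul_tmul', ← add_smul]
  norm_num

theorem tensor_decomp (hn : 5 ≤ n) (t : so n ⊗[ℂ] so n) : ∃ c : ℂ,
    t - c • cartanVec n ∈ lowerPart (LieModule.toEnd ℂ (so n) (so n ⊗[ℂ] so n) (coweight n)) 4 := by
  induction t using TensorProduct.induction_on with
  | zero => exact ⟨0, by simp⟩
  | add s t hs ht =>
    obtain ⟨c, hc⟩ := hs
    obtain ⟨d, hd⟩ := ht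
    refine ⟨c + d, ?_⟩
    have := add_mem hc hd
    rwa [show s - c • cartanVec n + (t - d • cartanVec n) = s + t - (c + d) • cartanVec n by
      rw [add_smul]; abel] at this
  | tmul x y =>
    obtain ⟨_, hv, x', hx', rfl⟩ := Submodule.mem_sup.1 (so_decomp hn x)
    obtain ⟨c, rfl⟩ := Submodule.mem_span_singleton.1 hv
    obtain ⟨_, hv', y', hy', rfl⟩ := Submodule.mem_sup.1 (so_decomp hn y)
    obtain ⟨d, rfl⟩ := Submodule.mem_span_singleton.1 hv'
    have hv3 : rootVec n ∈ lowerPart (LieModule.toEnd ℂ (so n) (so n) (coweight n)) 3 :=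
      Submodule.subset_span ⟨2, by norm_num, lie_coweight_rootVec hn⟩
    refine ⟨c * d, ?_⟩
    have e : (c • rootVec n + x') ⊗ₜ[ℂ] (d • rootVec n + y') - (c * d) • cartanVec n =
        (c • rootVec n) ⊗ₜ[ℂ] y' + x' ⊗ₜ[ℂ] (d • rootVec n) + x' ⊗ₜ[ℂ] y' := by
      simp only [cartanVec, TensorProduct.add_tmul, TensorProduct.tmul_add,
        ← TensorProduct.smul_tmul', TensorProduct.tmul_smul, smul_add, smul_smul]
      rw [mul_comm d c]
      abel
    rw [e]
    refine add_mem (add_mem ?_ ?_) ?_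
    · exact tmul_mem_lowerPart _ (by norm_num) (Submodule.smul_mem _ c hv3) hy'
    · exact tmul_mem_lowerPart _ (by norm_num) hx' (Submodule.smul_mem _ d hv3)
    · exact tmul_mem_lowerPart _ (by norm_num) hx' hy'

theorem eq_smul_cartanVec (hn : 5 ≤ n) {t : so n ⊗[ℂ] so n}
    (ht : ⁅coweight n, t⁆ = ((4 : ℤ) : ℂ) • t) : ∃ c : ℂ, t = c • cartanVec n := by
  obtain ⟨c, hc⟩ := tensor_decomp hn t
  refine ⟨c, sub_eq_zero.1 (eq_zero_of_mem_lowerPart _ hc ?_)⟩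
  rw [LieModule.toEnd_apply_apply, lie_sub, lie_smul, ht, lie_coweight_cartanVec hn, smul_sub,
    smul_comm]

/-- The embedding of `so(n, ℂ) ⊗ so(n, ℂ)` into matrices by the Kronecker product. -/
def kron (n : ℕ) : so n ⊗[ℂ] so n →ₗ[ℂ] Matrix (Fin n × Fin n) (Fin n × Fin n) ℂ :=
  TensorProduct.lift ((Matrix.kroneckerBilinear (R := ℂ) (α := ℂ)).compl₁₂
    (so n).toSubmodule.subtype (so n).toSubmodule.subtype)

theorem kron_tmul (X Y : so n) : kron n (X ⊗ₜ Y) =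
    (X : Matrix (Fin n) (Fin n) ℂ) ⊗ₖ (Y : Matrix (Fin n) (Fin n) ℂ) := rfl

theorem kron_injective (n : ℕ) : Function.Injective (kron n) := by
  have h1 : Function.Injective (TensorProduct.map (so n).toSubmodule.subtype
      (so n).toSubmodule.subtype) :=
    TensorProduct.map_injective_of_flat_flat _ _ (so n).toSubmodule.injective_subtype
      (so n).toSubmodule.injective_subtype
  have h2 := (kroneckerTMulLinearEquiv (Fin n) (Fin n) (Fin n) (Fin n) ℂ ℂ ℂ ℂ).injective
  have h3 : Function.Injective (fun A : Matrix (Fin n × Fin n) (Fin n × Fin n) (ℂ ⊗[ℂ] ℂ) =>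
      A.map (TensorProduct.lid ℂ ℂ)) := fun A B h => by
    ext i j
    exact (TensorProduct.lid ℂ ℂ).injective (congrFun (congrFun h i) j)
  have h4 : ∀ t, kron n t = (kroneckerTMulLinearEquiv (Fin n) (Fin n) (Fin n) (Fin n) ℂ ℂ ℂ ℂ
      (TensorProduct.map (so n).toSubmodule.subtype (so n).toSubmodule.subtype t)).map
        (TensorProduct.lid ℂ ℂ) := by
    intro t
    induction t using TensorProduct.induction_on with
    | zero => ext; simp
    | add s t hs ht =>
      rw [map_add, hs, ht, map_add, map_add]
      ext
      simp
    | tmul X Y =>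
      ext i j
      simp [kron_tmul]
  intro s t hst
  rw [h4, h4] at hst
  exact h1 (h2 (h3 hst))

theorem kron_lie (X : so n) (t : so n ⊗[ℂ] so n) : kron n ⁅X, t⁆ =
    ((X : Matrix (Fin n) (Fin n) ℂ) ⊗ₖ 1 + 1 ⊗ₖ (X : Matrix (Fin n) (Fin n) ℂ)) * kron n t -
    kron n t * ((X : Matrix (Fin n) (Fin n) ℂ) ⊗ₖ 1 + 1 ⊗ₖ (X : Matrix (Fin n) (Fin n) ℂ)) := by
  induction t using TensorProduct.induction_on with
  | zero => simp
  | add s t hs ht =>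
    rw [lie_add, map_add, hs, ht, map_add]
    noncomm_ring
  | tmul Y Z =>
    rw [TensorProduct.LieModule.lie_tmul_right, map_add, kron_tmul, kron_tmul, kron_tmul]
    simp only [LieSubalgebra.coe_bracket, Ring.lie_def, add_mul, mul_add,
      ← Matrix.mul_kronecker_mul, Matrix.one_mul, Matrix.mul_one]
    ext i j
    simp
    ring

open scoped ComplexOrder in
theorem exists_isCompl (N : LieSubmodule ℂ (so n) (so n ⊗[ℂ] so n)) :
    ∃ K : LieSubmodule ℂ (so n) (so n ⊗[ℂ] so n), IsCompl N.toSubmodule K.toSubmodule := by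
  -- the orthogonal complement for an invariant Hermitian inner product
  have star_mem : ∀ X : so n, (X : Matrix (Fin n) (Fin n) ℂ)ᴴ ∈ so n := by
    intro X
    have h := (LieAlgebra.Orthogonal.mem_so (Fin n) ℂ _).1 X.2
    rw [LieAlgebra.Orthogonal.mem_so, Matrix.conjTranspose, ← Matrix.transpose_map, h]
    ext i j
    simp [so_skew X i j]
  have adj : ∀ (X : so n) (s t : so n ⊗[ℂ] so n), ((kron n s)ᴴ * kron n ⁅X, t⁆).trace =
      ((kron n ⁅(⟨_, star_mem X⟩ : so n), s⁆)ᴴ * kron n t).trace := by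
    intro X s t
    rw [kron_lie, kron_lie]
    simp only [Matrix.conjTranspose_sub, Matrix.conjTranspose_mul, Matrix.conjTranspose_add,
      Matrix.conjTranspose_kronecker, Matrix.conjTranspose_conjTranspose,
      Matrix.conjTranspose_one, mul_sub, sub_mul, Matrix.trace_sub]
    rw [Matrix.mul_assoc, Matrix.trace_mul_comm _ (kron n t * _)]
    simp only [Matrix.mul_assoc]
    rw [Matrix.trace_mul_comm (kron n t)]
    simp only [Matrix.mul_assoc]
  let K : LieSubmodule ℂ (so n) (so n ⊗[ℂ] so n) :=
    { carrier := {t | ∀ s ∈ N, ((kron n s)ᴴ * kron n t).trace = 0}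
      zero_mem' := fun s _ => by simp
      add_mem' := fun {t t'} ht ht' s hs => by
        rw [map_add, mul_add, Matrix.trace_add, ht s hs, ht' s hs, add_zero]
      smul_mem' := fun c t ht s hs => by
        rw [map_smul, Matrix.mul_smul, Matrix.trace_smul, ht s hs, smul_zero]
      lie_mem := fun {X t} ht s hs => by
        rw [adj]
        exact ht _ (N.lie_mem hs) }
  refine ⟨K, ?_, ?_⟩
  · rw [Submodule.disjoint_def]
    intro t ht htK
    have h : ((kron n t)ᴴ * kron n t).trace = 0 := htK t ht
    rw [Matrix.trace_conjTranspose_mul_self_eq_zero_iff] at h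
    exact kron_injective n (by rw [h, map_zero])
  · let Φ : so n ⊗[ℂ] so n →ₗ[ℂ] EuclideanSpace ℂ ((Fin n × Fin n) × (Fin n × Fin n)) :=
      { toFun := fun t => WithLp.toLp 2 fun p => kron n t p.1 p.2
        map_add' := fun s t => by ext; simp
        map_smul' := fun c t => by ext; simp }
    have hΦ : ∀ s t, inner ℂ (Φ s) (Φ t) = ((kron n s)ᴴ * kron n t).trace := by
      intro s t
      change (fun p : (Fin n × Fin n) × (Fin n × Fin n) => kron n t p.1 p.2) ⬝ᵥ
        star (fun p : (Fin n × Fin n) × (Fin n × Fin n) => kron n s p.1 p.2) = _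
      rw [dotProduct, Fintype.sum_prod_type, Finset.sum_comm]
      simp only [Matrix.trace, Matrix.diag, Matrix.mul_apply, Matrix.conjTranspose_apply,
        Pi.star_apply]
      exact Finset.sum_congr rfl fun i _ => Finset.sum_congr rfl fun j _ => mul_comm _ _
    rw [codisjoint_iff, eq_top_iff]
    intro t _
    obtain ⟨y, hy, z, hz, h⟩ :=
      (N.toSubmodule.map Φ).exists_add_mem_mem_orthogonal (Φ t)
    obtain ⟨s, hs, rfl⟩ := hy
    refine Submodule.mem_sup.2 ⟨s, hs, t - s, ?_, by abel⟩
    intro s' hs'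
    rw [← hΦ, map_sub, h, add_sub_cancel_left]
    exact hz _ (Submodule.mem_map_of_mem hs')

theorem cartanVec_ne_zero (hn : 5 ≤ n) : cartanVec n ≠ 0 := by
  intro h
  have := congrFun (congrFun (congrArg (kron n) h) (⟨0, by omega⟩, ⟨0, by omega⟩))
    (⟨2, by omega⟩, ⟨2, by omega⟩)
  rw [cartanVec, kron_tmul, Matrix.kronecker_apply, rootVec, wedge_apply] at this
  simp [isoVec] at this

/-- The submodule generated by the highest weight vector. -/
def cartanSubmodule (n : ℕ) : LieSubmodule ℂ (so n) (so n ⊗[ℂ] so n) :=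
  LieSubmodule.lieSpan ℂ (so n) {cartanVec n}

theorem cartanVec_mem (n : ℕ) : cartanVec n ∈ cartanSubmodule n :=
  LieSubmodule.subset_lieSpan rfl

theorem cartanSubmodule_le {N : LieSubmodule ℂ (so n) (so n ⊗[ℂ] so n)} (h : cartanVec n ∈ N) :
    cartanSubmodule n ≤ N :=
  LieSubmodule.lieSpan_le.2 (Set.singleton_subset_iff.2 h)

theorem eq_bot_or_eq_cartanSubmodule (hn : 5 ≤ n) {M : LieSubmodule ℂ (so n) (so n ⊗[ℂ] so n)}
    (hM : M ≤ cartanSubmodule n) : M = ⊥ ∨ M = cartanSubmodule n := by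
  obtain ⟨K, hK⟩ := exists_isCompl M
  obtain ⟨a, ha, b, hb, hab⟩ := Submodule.mem_sup.1
    (show cartanVec n ∈ M.toSubmodule ⊔ K.toSubmodule by rw [hK.sup_eq_top]; trivial)
  have hdisj := Submodule.disjoint_def.1 hK.disjoint
  have hD := lie_coweight_cartanVec hn
  rw [← hab, lie_add, smul_add] at hD
  have hz : ⁅coweight n, a⁆ - ((4 : ℤ) : ℂ) • a = 0 := by
    refine hdisj _ (sub_mem (M.lie_mem ha) (M.smul_mem _ ha)) ?_
    rw [show ⁅coweight n, a⁆ - ((4 : ℤ) : ℂ) • a = ((4 : ℤ) : ℂ) • b - ⁅coweight n, b⁆ by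
      rw [sub_eq_sub_iff_add_eq_add, hD]; abel]
    exact sub_mem (K.smul_mem _ hb) (K.lie_mem hb)
  obtain ⟨c, hc⟩ := eq_smul_cartanVec hn (sub_eq_zero.1 hz)
  by_cases h0 : c = 0
  · left
    rw [h0, zero_smul] at hc
    rw [hc, zero_add] at hab
    have hCK : cartanSubmodule n ≤ K := cartanSubmodule_le (hab ▸ hb)
    rw [eq_bot_iff]
    intro x hx
    exact hdisj x hx (hCK (hM hx))
  · right
    refine le_antisymm hM (cartanSubmodule_le ?_)
    have : cartanVec n = c⁻¹ • a := by rw [hc, smul_smul, inv_mul_cancel₀ h0, one_smul]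
    rw [this]
    exact M.smul_mem _ ha

theorem isCartanComponent_cartanSubmodule (hn : 5 ≤ n) :
    IsCartanComponent (borel n) (cartanSubmodule n) := by
  constructor
  · have : Nontrivial (cartanSubmodule n) :=
      ⟨⟨⟨cartanVec n, cartanVec_mem n⟩, 0, fun h => cartanVec_ne_zero hn (congrArg Subtype.val h)⟩⟩
    refine LieModule.IsIrreducible.mk ?_
    intro N hN
    rcases eq_bot_or_eq_cartanSubmodule hn
      (M := N.map (cartanSubmodule n).incl) (by
        rintro _ ⟨x, _, rfl⟩
        exact x.2) with h | h
    · refine absurd ?_ hN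
      rw [eq_bot_iff]
      intro x hx
      have : (x : so n ⊗[ℂ] so n) ∈ N.map (cartanSubmodule n).incl := ⟨x, hx, rfl⟩
      rw [h, LieSubmodule.mem_bot] at this
      exact Subtype.ext this
    · rw [eq_top_iff]
      intro x _
      have hx : (x : so n ⊗[ℂ] so n) ∈ N.map (cartanSubmodule n).incl := by rw [h]; exact x.2
      obtain ⟨y, hy, hyx⟩ := hx
      have : y = x := Subtype.ext hyx
      exact this ▸ hy
  · obtain ⟨χ, hχ⟩ := exists_highestWeight hn
    refine ⟨χ, ⟨rootVec n, rootVec_ne_zero hn, hχ⟩, ⟨cartanVec n, cartanVec_mem n⟩,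
      fun h => cartanVec_ne_zero hn (congrArg Subtype.val h), fun X => Subtype.ext ?_⟩
    change ⁅(X : so n), cartanVec n⁆ = (2 • χ) X • cartanVec n
    rw [cartanVec, TensorProduct.LieModule.lie_tmul_right, hχ, TensorProduct.tmul_smul,
      ← TensorProduct.smul_tmul', ← add_smul]
    simp [two_mul]

theorem IsCartanComponent.eq_cartanSubmodule (hn : 5 ≤ n)
    {C : LieSubmodule ℂ (so n) (so n ⊗[ℂ] so n)} (hC : IsCartanComponent (borel n) C) :
    C = cartanSubmodule n := by
  obtain ⟨χ, ⟨w, hw0, hw⟩, ⟨t, ht0, ht⟩⟩ := hC.highestWeight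
  obtain ⟨c, hc⟩ := eq_smul_rootVec hn hw
  have hχ : χ ⟨_, coweight_mem_borel hn⟩ = 2 := by
    have h := hw ⟨_, coweight_mem_borel hn⟩
    change ⁅coweight n, w⁆ = _ at h
    rw [hc, lie_smul, lie_coweight_rootVec hn, smul_comm, ← hc] at h
    simpa using (smul_left_injective ℂ hw0 h).symm
  have h := congrArg Subtype.val (ht ⟨_, coweight_mem_borel hn⟩)
  change ⁅coweight n, (t : so n ⊗[ℂ] so n)⁆ = (2 • χ) ⟨_, coweight_mem_borel hn⟩ •
    (t : so n ⊗[ℂ] so n) at h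
  rw [LinearMap.smul_apply, hχ] at h
  obtain ⟨d, hd⟩ := eq_smul_cartanVec hn (t := t) (by rw [h]; norm_num)
  have hd0 : d ≠ 0 := by
    rintro rfl
    rw [zero_smul] at hd
    exact ht0 (Subtype.ext hd)
  have hmem : cartanVec n ∈ C := by
    have : cartanVec n = d⁻¹ • (t : so n ⊗[ℂ] so n) := by
      rw [hd, smul_smul, inv_mul_cancel₀ hd0, one_smul]
    rw [this]
    exact C.smul_mem _ t.2
  have hle := cartanSubmodule_le hmem
  have := hC.irreducible
  have htop : (cartanSubmodule n).comap C.incl = ⊤ := by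
    refine (eq_bot_or_eq_top _).resolve_left ?_
    intro hbot
    have : (⟨cartanVec n, hmem⟩ : C) ∈ (cartanSubmodule n).comap C.incl := cartanVec_mem n
    rw [hbot, LieSubmodule.mem_bot] at this
    exact cartanVec_ne_zero hn (congrArg Subtype.val this)
  refine le_antisymm (fun x hx => ?_) hle
  have : (⟨x, hx⟩ : C) ∈ (cartanSubmodule n).comap C.incl := by rw [htop]; trivial
  exact this

theorem map_mem_lowerPart (F : so n ⊗[ℂ] so n →ₗ⁅ℂ, so n⁆ so n ⊗[ℂ] so n) {k : ℤ}
    {t : so n ⊗[ℂ] so n}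
    (ht : t ∈ lowerPart (LieModule.toEnd ℂ (so n) (so n ⊗[ℂ] so n) (coweight n)) k) :
    F t ∈ lowerPart (LieModule.toEnd ℂ (so n) (so n ⊗[ℂ] so n) (coweight n)) k := by
  induction ht using Submodule.span_induction with
  | zero => simp
  | add x y _ _ hx hy => rw [map_add]; exact add_mem hx hy
  | smul c x _ hx => rw [map_smul]; exact Submodule.smul_mem _ c hx
  | mem x hx =>
    obtain ⟨m, hm, hx⟩ := hx
    refine Submodule.subset_span ⟨m, hm, ?_⟩
    rw [LieModule.toEnd_apply_apply] at hx ⊢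
    rw [← LieModuleHom.map_lie, hx, map_smul]

/-- There is exactly one invariant projection of `so(n, ℂ) ⊗ so(n, ℂ)` onto its Cartan
component. -/
theorem existsUnique_isCartanProjection (hn : 5 ≤ n) :
    ∃! P : so n ⊗[ℂ] so n →ₗ⁅ℂ, so n⁆ so n ⊗[ℂ] so n, IsCartanProjection (borel n) P := by
  obtain ⟨K, hK⟩ := exists_isCompl (cartanSubmodule n)
  let P : so n ⊗[ℂ] so n →ₗ⁅ℂ, so n⁆ so n ⊗[ℂ] so n :=
    { Submodule.projection _ _ hK with
      map_lie' := fun {X t} => by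
        change Submodule.projection _ _ hK ⁅X, t⁆ = ⁅X, Submodule.projection _ _ hK t⁆
        have h1 := (cartanSubmodule n).lie_mem (x := X) (Submodule.projection_apply_mem hK t)
        have h2 := K.lie_mem (x := X) (Submodule.sub_projection_mem hK t)
        rw [lie_sub] at h2
        have h3 := (Submodule.projection_apply_eq_zero_iff hK).2 h2
        rw [map_sub, sub_eq_zero] at h3
        rw [h3]
        exact Submodule.projection_apply_of_mem_left hK h1 }
  refine ⟨P, ⟨cartanSubmodule n, isCartanComponent_cartanSubmodule hn,
    ⟨fun t => Submodule.projection_apply_mem hK t,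
      fun t ht => Submodule.projection_apply_of_mem_left hK ht⟩⟩, ?_⟩
  rintro Q ⟨C, hC, hQ⟩
  obtain rfl := hC.eq_cartanSubmodule hn
  have hR : ∀ t, (Q - P) t = Q t - P t := fun t => rfl
  have hvan : ∀ t ∈ cartanSubmodule n, (Q - P) t = 0 := by
    intro t ht
    rw [hR, sub_eq_zero]
    exact (hQ.map_id t ht).trans (Submodule.projection_apply_of_mem_left hK ht).symm
  have hle : (Q - P).range ≤ cartanSubmodule n := by
    rintro _ ⟨t, rfl⟩
    exact sub_mem (hQ.map_mem t) (Submodule.projection_apply_mem hK t)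
  rcases eq_bot_or_eq_cartanSubmodule hn hle with h | h
  · ext t
    have : (Q - P) t ∈ (Q - P).range := ⟨t, rfl⟩
    rw [h, LieSubmodule.mem_bot, hR, sub_eq_zero] at this
    exact this
  · exfalso
    have hv : cartanVec n ∈ (Q - P).range := by rw [h]; exact cartanVec_mem n
    obtain ⟨t, ht⟩ := hv
    obtain ⟨c, hc⟩ := tensor_decomp hn t
    have hm := map_mem_lowerPart (Q - P) hc
    have e : (Q - P) (t - c • cartanVec n) = cartanVec n := by
      rw [map_sub, map_smul, hvan _ (cartanVec_mem n), smul_zero, sub_zero]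
      exact ht
    rw [e] at hm
    exact cartanVec_ne_zero hn (eq_zero_of_mem_lowerPart _ hm (lie_coweight_cartanVec hn))

end Wedge

/-! ### The ideal -/

/-- The invariant projection `X ⊗ Y ↦ X ⊚ Y` of `so(n, ℂ) ⊗ so(n, ℂ)` onto its Cartan
component. -/
def cartanProjection (n : ℕ) (hn : 5 ≤ n) : so n ⊗[ℂ] so n →ₗ⁅ℂ, so n⁆ so n ⊗[ℂ] so n :=
  (existsUnique_isCartanProjection hn).choose

theorem isCartanProjection_cartanProjection (n : ℕ) (hn : 5 ≤ n) :
    IsCartanProjection (borel n) (cartanProjection n hn) :=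
  (existsUnique_isCartanProjection hn).choose_spec.1

/-- The element `X ⊗ Y - X ⊚ Y - ½ [X, Y] - lam ⟨X, Y⟩` of the tensor algebra of `so(n, ℂ)`,
where `⟨ , ⟩` is the Killing form. -/
def josephGenerator (n : ℕ) (hn : 5 ≤ n) (lam : ℂ) (X Y : so n) : TensorAlgebra ℂ (so n) :=
  TensorAlgebra.ι ℂ X * TensorAlgebra.ι ℂ Y - tensorTwo (so n) (cartanProjection n hn (X ⊗ₜ Y)) -
    (1 / 2 : ℂ) • TensorAlgebra.ι ℂ ⁅X, Y⁆ -
    algebraMap ℂ (TensorAlgebra ℂ (so n)) (lam * killingForm ℂ (so n) X Y)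

/-- The two-sided ideal of the tensor algebra generated by all the elements
`X ⊗ Y - X ⊚ Y - ½ [X, Y] - lam ⟨X, Y⟩`. -/
def josephIdeal (n : ℕ) (hn : 5 ≤ n) (lam : ℂ) : TwoSidedIdeal (TensorAlgebra ℂ (so n)) :=
  TwoSidedIdeal.span {x | ∃ X Y : so n, x = josephGenerator n hn lam X Y}

end Joseph

end

/-!
In the quotient of the tensor algebra by the ideal, a tensor `t` killed by the projection onto the
Cartan component is equal to half its bracket plus `lam` times its Killing contraction. Two
families of such tensors suffice: the cyclic sums `x∧y ⊗ z∧w + x∧z ⊗ w∧y + x∧w ⊗ y∧z`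
(`cartanProjection_pluckerTensor`) and the contractions `∑ₐ x∧eₐ ⊗ eₐ∧y`
(`cartanProjection_contractTensor`). Each family spans an invariant subspace without a vector of
the highest weight, so its image under the projection is a proper submodule of the irreducible
Cartan component, hence zero (`cartanProjection_eq_zero_of_mem`).

Let `M i j` be the image of `eᵢ∧eⱼ` in the quotient and `s = 2 lam (n - 1) (n - 2)`. As the Killing
form is `(n - 2) tr (X Y)` (`killingForm_so`), the contractions give
`∑ₐ M i a * M a j = s δᵢⱼ + (n - 2) / 2 * M i j` (`wedgeImage_contract`), and the cyclic sums give
`M i j * M k l + M i k * M l j + M i l * M j k = -(δᵢₖ M j l + δᵢₗ M k j + δᵢⱼ M l k)`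
(`wedgeImage_plucker`). Multiplying the latter on the right by `M l k` and summing over `k` and `l`,
every product can be evaluated by the former; for `i ≠ j` the outcome is
`(n - 2) (s + (n - 4) / 2) M i j = 0` (`wedgeImage_eq_zero`). The scalar vanishes only for the
excluded value of `lam`, so all `M i j` are zero, and the `eᵢ∧eⱼ` span `so n`.
-/

attribute [local instance 100] LieRing.ofAssociativeRing

namespace Joseph

variable {n : ℕ}

/-! ### Tensors killed by the projection onto the Cartan component -/

/-- The coefficient of the highest root vector: up to the factor `4`, the coordinate of `X` along
`rootVec n` in the decomposition of `so n` into eigenspaces of `coweight n`. -/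
noncomputable def rootCoeff (n : ℕ) : so n →ₗ[ℂ] ℂ where
  toFun X := isoVec' n 0 ⬝ᵥ ((X : Matrix (Fin n) (Fin n) ℂ) *ᵥ isoVec' n 1)
  map_add' X Y := by simp [Matrix.add_mulVec, dotProduct_add]
  map_smul' c X := by simp [Matrix.smul_mulVec]

theorem rootCoeff_wedge (x y : Fin n → ℂ) : rootCoeff n (wedge x y) =
    (isoVec' n 0 ⬝ᵥ x) * (isoVec' n 1 ⬝ᵥ y) - (isoVec' n 0 ⬝ᵥ y) * (isoVec' n 1 ⬝ᵥ x) := by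
  change isoVec' n 0 ⬝ᵥ ((wedge x y : Matrix (Fin n) (Fin n) ℂ) *ᵥ isoVec' n 1) = _
  rw [wedge_mulVec, dotProduct_sub, dotProduct_smul, dotProduct_smul, dotProduct_comm y,
    dotProduct_comm x (isoVec' n 1)]
  simp only [smul_eq_mul]
  ring

theorem isoVec'_dot_coweight_mulVec (hn : 5 ≤ n) {j : ℕ} (hj : j < 2) (x : Fin n → ℂ) :
    isoVec' n j ⬝ᵥ ((coweight n : Matrix (Fin n) (Fin n) ℂ) *ᵥ x) = isoVec' n j ⬝ᵥ x := by
  have k : 2 * j + 1 < n := by omega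
  rw [coweight_mulVec]
  simp only [dotProduct_add, dotProduct_sub, dotProduct_smul, isoVec'_dot_isoVec k,
    isoVec'_dot_isoVec' k]
  obtain rfl | rfl : j = 0 ∨ j = 1 := by omega
  all_goals simp; ring

theorem rootCoeff_lie_coweight (hn : 5 ≤ n) (X : so n) :
    rootCoeff n ⁅coweight n, X⁆ = 2 * rootCoeff n X := by
  refine mem_of_wedge_mem (LinearMap.eqLocus
    (rootCoeff n ∘ₗ (LieModule.toEnd ℂ (so n) (so n) (coweight n))) ((2 : ℂ) • rootCoeff n))
    (fun x y => ?_) X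
  change rootCoeff n ⁅coweight n, wedge x y⁆ = 2 * rootCoeff n (wedge x y)
  rw [lie_wedge, map_add]
  simp only [rootCoeff_wedge, isoVec'_dot_coweight_mulVec hn (show 0 < 2 by omega),
    isoVec'_dot_coweight_mulVec hn (show 1 < 2 by omega)]
  ring

/-- The linear form `X ⊗ Y ↦ rootCoeff X * rootCoeff Y`, which detects the highest weight space of
`so n ⊗ so n`. -/
noncomputable def topCoeff (n : ℕ) : so n ⊗[ℂ] so n →ₗ[ℂ] ℂ :=
  TensorProduct.lift ((LinearMap.mul ℂ ℂ).compl₁₂ (rootCoeff n) (rootCoeff n))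

theorem topCoeff_tmul (X Y : so n) : topCoeff n (X ⊗ₜ Y) = rootCoeff n X * rootCoeff n Y := rfl

theorem topCoeff_lie_coweight (hn : 5 ≤ n) (t : so n ⊗[ℂ] so n) :
    topCoeff n ⁅coweight n, t⁆ = 4 * topCoeff n t := by
  induction t using TensorProduct.induction_on with
  | zero => simp
  | add s t hs ht => rw [lie_add, map_add, hs, ht, map_add]; ring
  | tmul X Y =>
    rw [TensorProduct.LieModule.lie_tmul_right, map_add]
    simp only [topCoeff_tmul, rootCoeff_lie_coweight hn]
    ring

theorem topCoeff_eq_zero_of_mem_lowerPart (hn : 5 ≤ n) {t : so n ⊗[ℂ] so n}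
    (ht : t ∈ lowerPart (LieModule.toEnd ℂ (so n) (so n ⊗[ℂ] so n) (coweight n)) 4) :
    topCoeff n t = 0 := by
  refine (Submodule.span_le (p := LinearMap.ker (topCoeff n))).2 ?_ ht
  rintro x ⟨m, hm, hx⟩
  have h := topCoeff_lie_coweight hn x
  rw [LieModule.toEnd_apply_apply] at hx
  rw [hx, map_smul, smul_eq_mul, ← sub_eq_zero, ← sub_mul] at h
  have hne : (m : ℂ) - 4 ≠ 0 := sub_ne_zero.2 (by exact_mod_cast hm.ne)
  exact (mul_eq_zero.1 h).resolve_left hne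

theorem topCoeff_cartanVec_ne_zero (hn : 5 ≤ n) : topCoeff n (cartanVec n) ≠ 0 := by
  rw [cartanVec, topCoeff_tmul, rootVec, rootCoeff_wedge,
    isoVec'_dot_isoVec (by omega), isoVec'_dot_isoVec (by omega), isoVec'_dot_isoVec (by omega),
    isoVec'_dot_isoVec (by omega)]
  norm_num

/-- An invariant subspace of `so n ⊗ so n` without a component of the highest weight is killed by
the projection: its image is a submodule of the irreducible Cartan component, and it misses the
highest weight vector. -/
theorem cartanProjection_eq_zero_of_mem (hn : 5 ≤ n)
    (N : LieSubmodule ℂ (so n) (so n ⊗[ℂ] so n)) (hN : ∀ t ∈ N, topCoeff n t = 0)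
    {t : so n ⊗[ℂ] so n} (ht : t ∈ N) : cartanProjection n hn t = 0 := by
  obtain ⟨C, hC, hP⟩ := isCartanProjection_cartanProjection n hn
  obtain rfl := hC.eq_cartanSubmodule hn
  have hle : N.map (cartanProjection n hn) ≤ cartanSubmodule n := by
    rintro _ ⟨s, _, rfl⟩
    exact hP.map_mem s
  have hmem : cartanProjection n hn t ∈ N.map (cartanProjection n hn) := ⟨t, ht, rfl⟩
  rcases eq_bot_or_eq_cartanSubmodule hn hle with h | h
  · rwa [h, LieSubmodule.mem_bot] at hmem
  · exfalso
    obtain ⟨s, hs, hsv⟩ : cartanVec n ∈ N.map (cartanProjection n hn) := h ▸ cartanVec_mem n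
    obtain ⟨c, hc⟩ := tensor_decomp hn s
    have hc0 : c = 0 := by
      have h0 := topCoeff_eq_zero_of_mem_lowerPart hn hc
      rw [map_sub, map_smul, hN s hs, zero_sub, neg_eq_zero, smul_eq_mul] at h0
      exact (mul_eq_zero.1 h0).resolve_right (topCoeff_cartanVec_ne_zero hn)
    rw [hc0, zero_smul, sub_zero] at hc
    have hm := map_mem_lowerPart (cartanProjection n hn) hc
    rw [show cartanProjection n hn s = cartanVec n from hsv] at hm
    exact cartanVec_ne_zero hn (eq_zero_of_mem_lowerPart _ hm (lie_coweight_cartanVec hn))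

theorem cartanProjection_eq_zero_of_mem_set (hn : 5 ≤ n) (S : Set (so n ⊗[ℂ] so n))
    (hS : ∀ X : so n, ∀ t ∈ S, ⁅X, t⁆ ∈ Submodule.span ℂ S) (h0 : ∀ t ∈ S, topCoeff n t = 0)
    {t : so n ⊗[ℂ] so n} (ht : t ∈ S) : cartanProjection n hn t = 0 := by
  refine cartanProjection_eq_zero_of_mem hn
    { Submodule.span ℂ S with
      lie_mem := fun {X s} hs => (Submodule.span_le (p := (Submodule.span ℂ S).comap
        (LieModule.toEnd ℂ (so n) (so n ⊗[ℂ] so n) X : _ →ₗ[ℂ] _))).2 (hS X) hs }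
    (fun s hs => (Submodule.span_le (p := LinearMap.ker (topCoeff n))).2 h0 hs)
    (Submodule.subset_span ht)

/-- The cyclic sum `x∧y ⊗ z∧w + x∧z ⊗ w∧y + x∧w ⊗ y∧z`. These tensors span the copy of the fourth
exterior power of `ℂⁿ` in `so n ⊗ so n`. -/
noncomputable def pluckerTensor (x y z w : Fin n → ℂ) : so n ⊗[ℂ] so n :=
  wedge x y ⊗ₜ wedge z w + wedge x z ⊗ₜ wedge w y + wedge x w ⊗ₜ wedge y z

/-- The coefficient of `pluckerTensor` at the highest weight vector vanishes by the Plücker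
relation. -/
theorem cartanProjection_pluckerTensor (hn : 5 ≤ n) (x y z w : Fin n → ℂ) :
    cartanProjection n hn (pluckerTensor x y z w) = 0 := by
  refine cartanProjection_eq_zero_of_mem_set hn
    {t | ∃ x y z w : Fin n → ℂ, t = pluckerTensor x y z w} ?_ ?_ ⟨x, y, z, w, rfl⟩
  · rintro X _ ⟨x, y, z, w, rfl⟩
    have h : ⁅X, pluckerTensor x y z w⁆ =
        pluckerTensor ((X : Matrix (Fin n) (Fin n) ℂ) *ᵥ x) y z w +
        pluckerTensor x ((X : Matrix (Fin n) (Fin n) ℂ) *ᵥ y) z w +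
        pluckerTensor x y ((X : Matrix (Fin n) (Fin n) ℂ) *ᵥ z) w +
        pluckerTensor x y z ((X : Matrix (Fin n) (Fin n) ℂ) *ᵥ w) := by
      simp only [pluckerTensor, lie_add, TensorProduct.LieModule.lie_tmul_right, lie_wedge,
        TensorProduct.add_tmul, TensorProduct.tmul_add]
      abel
    rw [h]
    exact add_mem (add_mem (add_mem (Submodule.subset_span ⟨_, _, _, _, rfl⟩)
      (Submodule.subset_span ⟨_, _, _, _, rfl⟩)) (Submodule.subset_span ⟨_, _, _, _, rfl⟩))
      (Submodule.subset_span ⟨_, _, _, _, rfl⟩)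
  · rintro _ ⟨x, y, z, w, rfl⟩
    simp only [pluckerTensor, map_add, topCoeff_tmul, rootCoeff_wedge]
    ring

/-- The contraction `∑ₐ x∧eₐ ⊗ eₐ∧y`. -/
noncomputable def contractTensor (x y : Fin n → ℂ) : so n ⊗[ℂ] so n :=
  ∑ a, wedge x (Pi.single a 1) ⊗ₜ wedge (Pi.single a 1) y

theorem lie_contractTensor (X : so n) (x y : Fin n → ℂ) : ⁅X, contractTensor x y⁆ =
    contractTensor ((X : Matrix (Fin n) (Fin n) ℂ) *ᵥ x) y +
      contractTensor x ((X : Matrix (Fin n) (Fin n) ℂ) *ᵥ y) := by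
  have hX : ∀ a : Fin n, (X : Matrix (Fin n) (Fin n) ℂ) *ᵥ Pi.single a 1 =
      ∑ b, (X : Matrix (Fin n) (Fin n) ℂ) b a • Pi.single b (1 : ℂ) := by
    intro a
    ext c
    simp [Pi.single_apply]
  -- the terms in which `X` acts on the contracted index cancel, because `X` is skew
  have h0 : ∑ a, (wedge x ((X : Matrix (Fin n) (Fin n) ℂ) *ᵥ Pi.single a 1) ⊗ₜ[ℂ]
        wedge (Pi.single a 1) y) +
      ∑ a, (wedge x (Pi.single a 1) ⊗ₜ[ℂ]
        wedge ((X : Matrix (Fin n) (Fin n) ℂ) *ᵥ Pi.single a 1) y) = 0 := by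
    simp only [hX, map_sum, map_smul, LinearMap.sum_apply, LinearMap.smul_apply,
      TensorProduct.sum_tmul, TensorProduct.tmul_sum, TensorProduct.tmul_smul,
      ← TensorProduct.smul_tmul']
    rw [Finset.sum_comm, ← Finset.sum_add_distrib]
    refine Finset.sum_eq_zero fun a _ => ?_
    rw [← Finset.sum_add_distrib]
    refine Finset.sum_eq_zero fun b _ => ?_
    rw [so_skew X a b, neg_smul, neg_add_cancel]
  simp only [contractTensor, lie_sum, TensorProduct.LieModule.lie_tmul_right, lie_wedge,
    TensorProduct.add_tmul, TensorProduct.tmul_add, Finset.sum_add_distrib]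
  rw [eq_neg_of_add_eq_zero_left h0]
  abel

/-- The coefficient of `contractTensor` at the highest weight vector vanishes because the flag
defining the Borel subalgebra is isotropic. -/
theorem cartanProjection_contractTensor (hn : 5 ≤ n) (x y : Fin n → ℂ) :
    cartanProjection n hn (contractTensor x y) = 0 := by
  refine cartanProjection_eq_zero_of_mem_set hn
    {t | ∃ x y : Fin n → ℂ, t = contractTensor x y} ?_ ?_ ⟨x, y, rfl⟩
  · rintro X _ ⟨x, y, rfl⟩
    rw [lie_contractTensor]
    exact add_mem (Submodule.subset_span ⟨_, _, rfl⟩) (Submodule.subset_span ⟨_, _, rfl⟩)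
  · rintro _ ⟨x, y, rfl⟩
    have h : ∀ j k : ℕ, 2 * j + 1 < n → ∑ a, isoVec' n j a * isoVec' n k a = 0 :=
      fun j k hj => isoVec'_dot_isoVec' hj
    simp only [contractTensor, map_sum, topCoeff_tmul, rootCoeff_wedge, dotProduct_single, mul_one]
    calc _ = (isoVec' n 0 ⬝ᵥ x) * (isoVec' n 1 ⬝ᵥ y) * (∑ a, isoVec' n 1 a * isoVec' n 0 a)
          - (isoVec' n 0 ⬝ᵥ x) * (isoVec' n 0 ⬝ᵥ y) * (∑ a, isoVec' n 1 a * isoVec' n 1 a)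
          - (isoVec' n 1 ⬝ᵥ x) * (isoVec' n 1 ⬝ᵥ y) * (∑ a, isoVec' n 0 a * isoVec' n 0 a)
          + (isoVec' n 1 ⬝ᵥ x) * (isoVec' n 0 ⬝ᵥ y) * (∑ a, isoVec' n 0 a * isoVec' n 1 a) := by
          simp only [Finset.mul_sum, ← Finset.sum_sub_distrib, ← Finset.sum_add_distrib]
          exact Finset.sum_congr rfl fun a _ => by ring
      _ = 0 := by
          rw [h 0 0 (by omega), h 0 1 (by omega), h 1 0 (by omega), h 1 1 (by omega)]
          ring

/-! ### The Killing form -/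

theorem trace_matrix_end (T : Matrix (Fin n) (Fin n) ℂ →ₗ[ℂ] Matrix (Fin n) (Fin n) ℂ) :
    LinearMap.trace ℂ _ T = ∑ i, ∑ j, T (Matrix.single i j 1) i j := by
  rw [LinearMap.trace_eq_matrix_trace ℂ (Matrix.stdBasis ℂ (Fin n) (Fin n)), Matrix.trace,
    Fintype.sum_prod_type]
  refine Finset.sum_congr rfl fun i _ => Finset.sum_congr rfl fun j _ => ?_
  rw [Matrix.diag_apply, LinearMap.toMatrix_apply, Matrix.stdBasis_eq_single]
  rfl

/-- The projection `A ↦ (A - Aᵀ) / 2` of all matrices onto skew ones. -/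
noncomputable def skewPart (n : ℕ) : Matrix (Fin n) (Fin n) ℂ →ₗ[ℂ] so n where
  toFun A := ⟨(1 / 2 : ℂ) • (A - Aᵀ), by
    rw [LieAlgebra.Orthogonal.mem_so, Matrix.transpose_smul, Matrix.transpose_sub,
      Matrix.transpose_transpose, ← smul_neg, neg_sub]⟩
  map_add' A B := by
    apply Subtype.ext
    change (1 / 2 : ℂ) • (A + B - (A + B)ᵀ) = (1 / 2 : ℂ) • (A - Aᵀ) + (1 / 2 : ℂ) • (B - Bᵀ)
    rw [Matrix.transpose_add, ← smul_add]
    congr 1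
    abel
  map_smul' c A := by
    apply Subtype.ext
    change (1 / 2 : ℂ) • (c • A - (c • A)ᵀ) = c • (1 / 2 : ℂ) • (A - Aᵀ)
    rw [Matrix.transpose_smul, ← smul_sub, smul_comm]

theorem skewPart_coe (X : so n) : skewPart n (X : Matrix (Fin n) (Fin n) ℂ) = X := by
  apply Subtype.ext
  change (1 / 2 : ℂ) • ((X : Matrix (Fin n) (Fin n) ℂ) - (X : Matrix (Fin n) (Fin n) ℂ)ᵀ) = X
  rw [(LieAlgebra.Orthogonal.mem_so (Fin n) ℂ _).1 X.2]
  module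

theorem mul_single_mul_apply (L R : Matrix (Fin n) (Fin n) ℂ) (i j k l : Fin n) :
    (L * Matrix.single i j (1 : ℂ) * R) k l = L k i * R j l := by
  rw [Matrix.mul_assoc, Matrix.mul_apply, Finset.sum_eq_single i]
  · rw [Matrix.single_mul_apply_same, one_mul]
  · intro b _ hb
    rw [Matrix.single_mul_apply_of_ne _ _ _ _ _ hb, mul_zero]
  · simp

/-- The Killing form of `so(n, ℂ)` is `(n - 2)` times the trace form of the standard
representation. -/
theorem killingForm_so (X Y : so n) : killingForm ℂ (so n) X Y =
    ((n : ℂ) - 2) * ((X : Matrix (Fin n) (Fin n) ℂ) * (Y : Matrix (Fin n) (Fin n) ℂ)).trace := by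
  obtain ⟨A, hA⟩ : ∃ A : Matrix (Fin n) (Fin n) ℂ, (X : Matrix (Fin n) (Fin n) ℂ) = A := ⟨_, rfl⟩
  obtain ⟨B, hB⟩ : ∃ B : Matrix (Fin n) (Fin n) ℂ, (Y : Matrix (Fin n) (Fin n) ℂ) = B := ⟨_, rfl⟩
  have hAs : ∀ i j, A i j = - A j i := fun i j => hA ▸ so_skew X i j
  have hBs : ∀ i j, B i j = - B j i := fun i j => hB ▸ so_skew Y i j
  have hAd : ∀ i, A i i = 0 := fun i => by linear_combination hAs i i / 2
  have hBd : ∀ i, B i i = 0 := fun i => by linear_combination hBs i i / 2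
  let ι := (so n).toSubmodule.subtype
  have h1 : killingForm ℂ (so n) X Y = LinearMap.trace ℂ _
      (ι ∘ₗ (LieAlgebra.ad ℂ (so n) X ∘ₗ LieAlgebra.ad ℂ (so n) Y) ∘ₗ skewPart n) := by
    have hid : skewPart n ∘ₗ ι = LinearMap.id := LinearMap.ext skewPart_coe
    rw [LinearMap.trace_comp_comm', LinearMap.comp_assoc, hid, LinearMap.comp_id]
    rfl
  have h2 : ∀ E : Matrix (Fin n) (Fin n) ℂ,
      (ι ∘ₗ (LieAlgebra.ad ℂ (so n) X ∘ₗ LieAlgebra.ad ℂ (so n) Y) ∘ₗ skewPart n) E =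
      (1 / 2 : ℂ) • ((A * B) * E * 1 - A * E * B - B * E * A + 1 * E * (B * A)
        - ((A * B) * Eᵀ * 1 - A * Eᵀ * B - B * Eᵀ * A + 1 * Eᵀ * (B * A))) := by
    intro E
    change ((⁅X, ⁅Y, skewPart n E⁆⁆ : so n) : Matrix (Fin n) (Fin n) ℂ) = _
    rw [LieSubalgebra.coe_bracket, LieSubalgebra.coe_bracket, hA, hB]
    change ⁅A, ⁅B, (1 / 2 : ℂ) • (E - Eᵀ)⁆⁆ = _
    rw [lie_smul, lie_smul]
    simp only [Ring.lie_def]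
    congr 1
    noncomm_ring
  rw [h1, trace_matrix_end, hA, hB]
  simp only [h2, Matrix.transpose_single, Matrix.smul_apply, Matrix.sub_apply, Matrix.add_apply,
    mul_single_mul_apply, smul_eq_mul, hAd, hBd]
  have e1 : ∑ i, ∑ j : Fin n, (A * B) i i * (1 : Matrix (Fin n) (Fin n) ℂ) j j =
      n * (A * B).trace := by
    simp [Matrix.trace, Finset.mul_sum]
  have e2 : ∑ i : Fin n, ∑ j, (1 : Matrix (Fin n) (Fin n) ℂ) i i * (B * A) j j =
      n * (A * B).trace := by
    rw [Matrix.trace_mul_comm]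
    simp [Matrix.trace]
  have e3 : ∑ i, ∑ j, (A * B) i j * (1 : Matrix (Fin n) (Fin n) ℂ) i j = (A * B).trace := by
    simp [Matrix.trace, Matrix.one_apply]
  have e4 : ∑ i, ∑ j, (1 : Matrix (Fin n) (Fin n) ℂ) i j * (B * A) i j = (A * B).trace := by
    rw [Matrix.trace_mul_comm]
    simp [Matrix.trace, Matrix.one_apply]
  have e5 : ∑ i, ∑ j, A i j * B i j = -(A * B).trace := by
    simp only [Matrix.trace, Matrix.diag_apply, Matrix.mul_apply, ← Finset.sum_neg_distrib]
    exact Finset.sum_congr rfl fun i _ => Finset.sum_congr rfl fun j _ => by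
      rw [hBs i j]; ring
  have e6 : ∑ i, ∑ j, B i j * A i j = -(A * B).trace := by
    simpa only [mul_comm] using e5
  have half : ∀ f : Fin n → Fin n → ℂ, ∑ i, ∑ j, 1 / 2 * f i j = 1 / 2 * ∑ i, ∑ j, f i j :=
    fun f => by simp only [Finset.mul_sum]
  simp only [half, Finset.sum_sub_distrib, Finset.sum_add_distrib, e1, e2, e3, e4, e5, e6]
  simp
  ring

theorem trace_wedge_mul_wedge (x y z w : Fin n → ℂ) :
    ((wedge x y : Matrix (Fin n) (Fin n) ℂ) * (wedge z w : Matrix (Fin n) (Fin n) ℂ)).trace =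
      2 * ((y ⬝ᵥ z) * (x ⬝ᵥ w) - (x ⬝ᵥ z) * (y ⬝ᵥ w)) := by
  simp only [coe_wedge, mul_sub, sub_mul, Matrix.vecMulVec_mul_vecMulVec, Matrix.trace_sub,
    Matrix.trace_vecMulVec, Matrix.vecMulVec_smul, Matrix.trace_smul, smul_eq_mul]
  ring

/-! ### Relations in a quotient of the tensor algebra -/

theorem eq_sum_smul_single (x : Fin n → ℂ) : x = ∑ a, x a • Pi.single a (1 : ℂ) := by
  ext c
  simp [Pi.single_apply]

theorem lie_wedge_wedge (x y z w : Fin n → ℂ) : ⁅wedge x y, wedge z w⁆ =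
    (y ⬝ᵥ z) • wedge x w - (x ⬝ᵥ z) • wedge y w + (y ⬝ᵥ w) • wedge z x -
      (x ⬝ᵥ w) • wedge z y := by
  rw [lie_wedge, wedge_mulVec, wedge_mulVec]
  simp only [map_sub, map_smul, LinearMap.sub_apply, LinearMap.smul_apply]
  abel

section Relations

variable {A : Type*} [Ring A] [Algebra ℂ A]

/-- A tensor killed by the projection onto the Cartan component reduces, in any algebra in which the
generators of the ideal vanish, to half its bracket plus `lam` times its Killing contraction. -/
theorem map_tensor_eq {hn : 5 ≤ n} {lam : ℂ} {φ : TensorAlgebra ℂ (so n) →ₐ[ℂ] A}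
    (hφ : ∀ X Y, φ (josephGenerator n hn lam X Y) = 0) {κ : Type*} (s : Finset κ) (X Y : κ → so n)
    (hP : cartanProjection n hn (∑ a ∈ s, X a ⊗ₜ Y a) = 0) :
    ∑ a ∈ s, φ (TensorAlgebra.ι ℂ (X a)) * φ (TensorAlgebra.ι ℂ (Y a)) =
      (1 / 2 : ℂ) • φ (TensorAlgebra.ι ℂ (∑ a ∈ s, ⁅X a, Y a⁆)) +
      algebraMap ℂ A (lam * ∑ a ∈ s, killingForm ℂ (so n) (X a) (Y a)) := by
  have h := Finset.sum_congr (rfl : s = s) fun a _ => hφ (X a) (Y a)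
  simp only [josephGenerator, map_sub, map_mul, map_smul, AlgHom.commutes,
    Finset.sum_sub_distrib, Finset.sum_const_zero] at h
  rw [← map_sum φ, ← map_sum (tensorTwo (so n)), ← map_sum (cartanProjection n hn), hP,
    map_zero, map_zero, sub_zero, sub_sub, sub_eq_zero] at h
  rw [h]
  simp only [map_sum, Finset.smul_sum, Finset.mul_sum, map_mul]

variable (φ : TensorAlgebra ℂ (so n) →ₐ[ℂ] A)

/-- The image in `A` of the skew matrix `x yᵀ - y xᵀ`. -/
noncomputable def wedgeImage (x y : Fin n → ℂ) : A := φ (TensorAlgebra.ι ℂ (wedge x y))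

variable {φ}

theorem wedgeImage_swap (x y : Fin n → ℂ) : wedgeImage φ x y = - wedgeImage φ y x := by
  rw [wedgeImage, wedge_swap, map_neg, map_neg, wedgeImage]

/-- The Plücker tensors are killed by the projection, so they reduce to terms of degree one. -/
theorem wedgeImage_plucker {hn : 5 ≤ n} {lam : ℂ}
    (hφ : ∀ X Y, φ (josephGenerator n hn lam X Y) = 0) (x y z w : Fin n → ℂ) :
    wedgeImage φ x y * wedgeImage φ z w + wedgeImage φ x z * wedgeImage φ w y +
      wedgeImage φ x w * wedgeImage φ y z =
    -((x ⬝ᵥ z) • wedgeImage φ y w + (x ⬝ᵥ w) • wedgeImage φ z y +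
      (x ⬝ᵥ y) • wedgeImage φ w z) := by
  have h := map_tensor_eq hφ (Finset.univ : Finset (Fin 3))
    ![wedge x y, wedge x z, wedge x w] ![wedge z w, wedge w y, wedge y z] (by
      rw [Fin.sum_univ_three]
      exact cartanProjection_pluckerTensor hn x y z w)
  simp only [Fin.sum_univ_three, Matrix.cons_val_zero, Matrix.cons_val_one, Matrix.cons_val] at h
  rw [wedgeImage, wedgeImage, wedgeImage, wedgeImage, wedgeImage, wedgeImage, h]
  -- the Killing terms cancel, and the brackets add up to twice the terms on the right
  have hk : killingForm ℂ (so n) (wedge x y) (wedge z w) +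
      killingForm ℂ (so n) (wedge x z) (wedge w y) +
      killingForm ℂ (so n) (wedge x w) (wedge y z) = 0 := by
    simp only [killingForm_so, trace_wedge_mul_wedge, dotProduct_comm z y, dotProduct_comm w y,
      dotProduct_comm w z]
    ring
  have hb : ⁅wedge x y, wedge z w⁆ + ⁅wedge x z, wedge w y⁆ + ⁅wedge x w, wedge y z⁆ =
      (2 : ℂ) • -((x ⬝ᵥ z) • wedge y w + (x ⬝ᵥ w) • wedge z y + (x ⬝ᵥ y) • wedge w z) := by
    simp only [lie_wedge_wedge, dotProduct_comm z y, dotProduct_comm w y, dotProduct_comm w z]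
    simp only [wedge_swap z x, wedge_swap w x, wedge_swap y x, wedge_swap z y, wedge_swap w z]
    module
  rw [hk, hb, mul_zero, map_zero, add_zero, map_smul, map_smul, smul_smul]
  simp [wedgeImage]

/-- The entries of the square of the matrix `wedgeImage φ eᵢ eⱼ`: a scalar matrix, given by the
Casimir element, plus a multiple of the matrix itself. -/
theorem wedgeImage_contract {hn : 5 ≤ n} {lam : ℂ}
    (hφ : ∀ X Y, φ (josephGenerator n hn lam X Y) = 0) (x y : Fin n → ℂ) :
    ∑ a, wedgeImage φ x (Pi.single a 1) * wedgeImage φ (Pi.single a 1) y =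
      (((n : ℂ) - 2) / 2) • wedgeImage φ x y +
        algebraMap ℂ A (2 * lam * ((n : ℂ) - 1) * ((n : ℂ) - 2) * (x ⬝ᵥ y)) := by
  have h := map_tensor_eq hφ Finset.univ (fun a : Fin n => wedge x (Pi.single a 1))
    (fun a => wedge (Pi.single a 1) y) (cartanProjection_contractTensor hn x y)
  have hb : ∑ a : Fin n, ⁅wedge x (Pi.single a 1), wedge (Pi.single a 1) y⁆ =
      ((n : ℂ) - 2) • wedge x y := by
    have h1 : ∑ a, x a • wedge (Pi.single a 1) y = wedge x y := by
      conv_rhs => rw [eq_sum_smul_single x]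
      simp
    have h2 : ∑ a, y a • wedge (Pi.single a 1) x = wedge y x := by
      conv_rhs => rw [eq_sum_smul_single y]
      simp
    simp only [lie_wedge_wedge, dotProduct_single, single_dotProduct, one_mul, mul_one,
      Pi.single_eq_same, wedge_self, smul_zero, sub_zero, Finset.sum_sub_distrib,
      Finset.sum_add_distrib, h1, h2, Finset.sum_const, Finset.card_univ, Fintype.card_fin,
      one_smul, wedge_swap y x]
    module
  have hk : ∑ a : Fin n, killingForm ℂ (so n) (wedge x (Pi.single a 1)) (wedge (Pi.single a 1) y) =
      2 * ((n : ℂ) - 1) * ((n : ℂ) - 2) * (x ⬝ᵥ y) := by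
    have hd : ∑ a, x a * y a = x ⬝ᵥ y := rfl
    simp only [killingForm_so, trace_wedge_mul_wedge, dotProduct_single, single_dotProduct,
      one_mul, mul_one, Pi.single_eq_same, ← Finset.mul_sum, Finset.sum_sub_distrib, hd,
      Finset.sum_const, Finset.card_univ, Fintype.card_fin, nsmul_eq_mul]
    ring
  rw [hb, hk, map_smul, map_smul, smul_smul] at h
  simp only [wedgeImage]
  rw [h]
  congr 2 <;> ring

/-- Multiplying the Plücker relation by `wedgeImage φ w z` and contracting over `z` and `w` leaves
a multiple of `wedgeImage φ x y`, which vanishes only for the exceptional value of `lam`. -/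
theorem wedgeImage_eq_zero {hn : 5 ≤ n} {lam : ℂ}
    (hlam : lam ≠ -(((n : ℂ) - 4) / (4 * ((n : ℂ) - 1) * ((n : ℂ) - 2))))
    (hφ : ∀ X Y, φ (josephGenerator n hn lam X Y) = 0) {i j : Fin n} (hij : i ≠ j) :
    wedgeImage φ (Pi.single i 1) (Pi.single j 1) = 0 := by
  obtain ⟨M, hM⟩ : ∃ M : Fin n → Fin n → A,
      ∀ i j, wedgeImage φ (Pi.single i 1) (Pi.single j 1) = M i j := ⟨_, fun _ _ => rfl⟩
  -- the scalar part of the square of `M`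
  obtain ⟨s, hs⟩ : ∃ s : ℂ, 2 * lam * ((n : ℂ) - 1) * ((n : ℂ) - 2) = s := ⟨_, rfl⟩
  have hswap : ∀ i j, M i j = - M j i := fun i j => by
    rw [← hM, ← hM, wedgeImage_swap]
  have hdot : ∀ i j : Fin n, (Pi.single i 1 : Fin n → ℂ) ⬝ᵥ Pi.single j 1 =
      if i = j then 1 else 0 := fun i j => by
    simp [Pi.single_apply, eq_comm]
  have hQ : ∀ i j, ∑ a, M i a * M a j =
      (((n : ℂ) - 2) / 2) • M i j + (if i = j then s else 0) • (1 : A) := by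
    intro i j
    have h := wedgeImage_contract hφ (Pi.single i 1) (Pi.single j 1)
    simp only [hM, hdot, hs, mul_ite, mul_one, mul_zero, Algebra.algebraMap_eq_smul_one] at h
    exact h
  have hR : ∀ j k l, M i j * M k l + M i k * M l j + M i l * M j k =
      -((if i = k then 1 else 0 : ℂ) • M j l + (if i = l then 1 else 0 : ℂ) • M k j +
        (if i = j then 1 else 0 : ℂ) • M l k) := by
    intro j k l
    have h := wedgeImage_plucker hφ (Pi.single i 1) (Pi.single j 1) (Pi.single k 1)
      (Pi.single l 1)
    simpa only [hM, hdot] using h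
  rw [hM]
  have hji := hQ j i
  have hQij := hQ i j
  rw [if_neg hij, zero_smul, add_zero] at hQij
  rw [if_neg (Ne.symm hij), zero_smul, add_zero, hswap j i] at hji
  have hd : ∀ i, M i i = 0 := fun i => by
    rw [← hM, wedgeImage, wedge_self, map_zero, map_zero]
  -- the three terms on the left of the contracted relation
  have t1 : ∑ k, ∑ l, M i j * M k l * M l k = ((n : ℂ) * s) • M i j := by
    simp only [mul_assoc, ← Finset.mul_sum, hQ, hd, if_true, smul_zero, zero_add, Finset.sum_const,
      Finset.card_univ, Fintype.card_fin, ← Nat.cast_smul_eq_nsmul ℂ, smul_smul,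
      mul_smul_comm, mul_one]
  have t2 : ∑ k, M i k * ((((n : ℂ) - 2) / 2) • M j k + (if j = k then s else 0) • (1 : A)) =
      (-(((n : ℂ) - 2) / 2) ^ 2 + s) • M i j := by
    simp only [mul_add, mul_smul_comm, mul_one, Finset.sum_add_distrib]
    simp only [ite_smul, zero_smul, Finset.sum_ite_eq, Finset.mem_univ, if_true]
    simp only [hswap j, mul_neg, smul_neg, Finset.sum_neg_distrib, ← Finset.smul_sum, hQij]
    module
  have t3 : ∑ k, ∑ l, M i k * M l j * M l k = -((-(((n : ℂ) - 2) / 2) ^ 2 + s) • M i j) := by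
    rw [← t2, ← Finset.sum_neg_distrib]
    refine Finset.sum_congr rfl fun k _ => ?_
    rw [← hQ j k, Finset.mul_sum, ← Finset.sum_neg_distrib]
    refine Finset.sum_congr rfl fun l _ => ?_
    rw [hswap l j]
    noncomm_ring
  have t4 : ∑ k, ∑ l, M i l * M j k * M l k = -((-(((n : ℂ) - 2) / 2) ^ 2 + s) • M i j) := by
    rw [Finset.sum_comm, ← t2, ← Finset.sum_neg_distrib]
    refine Finset.sum_congr rfl fun l _ => ?_
    rw [← hQ j l, Finset.mul_sum, ← Finset.sum_neg_distrib]
    refine Finset.sum_congr rfl fun k _ => ?_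
    rw [hswap l k]
    noncomm_ring
  -- the two surviving terms on the right
  have u1 : ∑ k, ∑ l, (if i = k then 1 else 0 : ℂ) • M j l * M l k =
      (-(((n : ℂ) - 2) / 2)) • M i j := by
    simp only [ite_smul, one_smul, zero_smul, ite_mul, zero_mul]
    rw [Finset.sum_comm]
    simp only [Finset.sum_ite_eq, Finset.mem_univ, if_true]
    rw [hji]
    module
  have u2 : ∑ k, ∑ l, (if i = l then 1 else 0 : ℂ) • M k j * M l k =
      (-(((n : ℂ) - 2) / 2)) • M i j := by
    simp only [ite_smul, one_smul, zero_smul, ite_mul, zero_mul, Finset.sum_ite_eq,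
      Finset.mem_univ, if_true]
    rw [show ∑ k, M k j * M i k = ∑ k, M j k * M k i from Finset.sum_congr rfl fun k _ => by
      rw [hswap k j, hswap i k, neg_mul_neg], hji]
    module
  have hsum : ∑ k, ∑ l, (M i j * M k l + M i k * M l j + M i l * M j k) * M l k =
      ∑ k, ∑ l, -((if i = k then 1 else 0 : ℂ) • M j l + (if i = l then 1 else 0 : ℂ) • M k j +
        (if i = j then 1 else 0 : ℂ) • M l k) * M l k :=
    Finset.sum_congr rfl fun k _ => Finset.sum_congr rfl fun l _ => by rw [hR]
  simp only [if_neg hij, zero_smul, add_zero, add_mul, neg_mul, neg_add, Finset.sum_add_distrib,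
    Finset.sum_neg_distrib, t1, t3, t4, u1, u2] at hsum
  have n2 : (n : ℂ) - 2 ≠ 0 := sub_ne_zero.2 (by exact_mod_cast (by omega : n ≠ 2))
  have n1 : (n : ℂ) - 1 ≠ 0 := sub_ne_zero.2 (by exact_mod_cast (by omega : n ≠ 1))
  -- the factor `s + (n - 4) / 2` vanishes exactly at the excluded value of `lam`
  have hfin : (((n : ℂ) - 2) * (s + ((n : ℂ) - 4) / 2)) • M i j = 0 := by
    rw [← sub_eq_zero] at hsum
    rw [← hsum]
    module
  refine (smul_eq_zero.1 hfin).resolve_left (mul_ne_zero n2 fun h => hlam ?_)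
  rw [← hs] at h
  field_simp
  linear_combination 2 * h

end Relations

end Joseph

/-! ### The ideal contains the Lie algebra -/

theorem theorem2 (n : ℕ) (hn : 5 ≤ n) (lam : ℂ)
    (hlam : lam ≠ -(((n : ℂ) - 4) / (4 * ((n : ℂ) - 1) * ((n : ℂ) - 2)))) :
    (LinearMap.range (TensorAlgebra.ι ℂ (M := Joseph.so n)) : Set (TensorAlgebra ℂ (Joseph.so n))) ⊆
      (Joseph.josephIdeal n hn lam : Set (TensorAlgebra ℂ (Joseph.so n))) := by
  rintro _ ⟨X, rfl⟩
  -- the quotient map of the tensor algebra by the ideal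
  let φ : TensorAlgebra ℂ (Joseph.so n) →ₐ[ℂ] (Joseph.josephIdeal n hn lam).ringCon.Quotient :=
    { (Joseph.josephIdeal n hn lam).ringCon.mk' with commutes' := fun _ => rfl }
  have hker : ∀ t, φ t = 0 ↔ t ∈ Joseph.josephIdeal n hn lam := fun t =>
    (RingCon.eq _).trans (TwoSidedIdeal.mem_iff _ t).symm
  have hφ : ∀ X Y, φ (Joseph.josephGenerator n hn lam X Y) = 0 := fun X Y =>
    (hker _).2 (TwoSidedIdeal.subset_span ⟨X, Y, rfl⟩)
  rw [SetLike.mem_coe, ← hker]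
  refine Joseph.mem_of_wedge_mem
    (LinearMap.ker (φ.toLinearMap ∘ₗ TensorAlgebra.ι ℂ)) (fun x y => ?_) X
  rw [Joseph.eq_sum_smul_single x, Joseph.eq_sum_smul_single y]
  simp only [map_sum, map_smul, LinearMap.sum_apply, LinearMap.smul_apply]
  refine Submodule.sum_mem _ fun i _ => Submodule.smul_mem _ _ <|
    Submodule.sum_mem _ fun j _ => Submodule.smul_mem _ _ ?_
  by_cases hij : i = j
  · rw [hij, Joseph.wedge_self]
    exact Submodule.zero_mem _
  · exact Joseph.wedgeImage_eq_zero hlam hφ (Ne.symm hij)
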